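/- **Proposition 4.3.** *Setting.* Let $n\ge 1$, let $K\subset\mathbb R^n$ be an open symmetric convex cone containing $\{\lambda:\lambda_i>0\ \forall i\}$, and let $f\in C^1(K)\cap C^0(\overline K)$ be symmetric, concave and homogeneous of degree one on $K$, with $f_i=\partial f/\partial\lambda_i>0$ and $f>0$ in $K$, $f=0$ on $\partial K$, and $f(1,\dots,1)=1$. Let $\Omega\subset\mathbb R^n$ be a bounded smooth domain whose boundary has nonnegative Euclidean mean curvature $\mathcal H_{\partial\Omega}\ge 0$ (with respect to the interior normal). Let $\sigma\in(0,1)$, $\varepsilon>0$, $0<T<\infty$, $\Omega_T=\Omega\times[0,T)$, and write $\overline\Omega_T=\overline\Omega\times[0,T)$. For a positive function $v$ put $w=w(v)=\sqrt{1+|Dv|^2}$ and $\gamma^{ij}=\delta_{ij}-\frac{v_iv_j}{w(1+w)}$. The hyperbolic principal curvatures $\kappa[v]$ of the graph of $v$ in the half-space model of $\mathbb H^{n+1}$ are the eigenvalues of $A[v]=\big(\tfrac1w(\delta_{ij}+v\,\gamma^{ik}v_{kl}\gamma^{lj})\big)$; put $F=f(\kappa[v])$ and $$G(D^2v,Dv,v,v_t)=\frac{v_t}{vw}-F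 .$$ Let $u>0$ be an admissible solution of the approximate problem $$G(D^2u,Du,u,u_t)=-\sigma\ \text{ in }\Omega_T,\qquad u=\varepsilon\ \text{ on }\partial\Omega\times[0,T),\qquad u(\cdot,0)=u_0+\varepsilon\ \text{ in }\Omega,$$ that is, $\kappa[u]\in K$ in $\Omega_T$ and $u$ is of class $C^{2,1}$ in the following sense: $u$ and $Du$ are continuous on $\overline\Omega_T$; $D^2u$ and $u_t$ exist and are continuous on $\overline\Omega_T\setminus(\partial\Omega\times\{0\})$; and $u_t$ is bounded on $\Omega\times[0,T']$ for every $T'<T$. *Claim.* Suppose that the initial surface, the graph of $u(\cdot,0)=u_0+\varepsilon$ over $\Omega$, satisfies $F\le\sigma$ and $\frac1{w(u_0)}>\sigma$ in $\Omega$. Then: 1. On $\overline\Omega_T\setminus(\partial\Omega\times\{0\})$ one has $\kappa[u]\in K$, the partial derivative $G_u=\partial G/\partial u$ (with $D^2u,Du,u_t$ held fixed) exists and satisfies $G_u\ge 0$, and $F\le\sigma$. 2. $w(u)\le\frac1\sigma$ on all of $\overline\Omega_T$ (a global gradient bound). 3. The linearized operator $\mathfrak L v=\frac{d}{ds}\Big|_{s=0}G\big(D^2(u+sv),D(u+sv),u+sv,(u+sv)_t\big)$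 satisfies the weak maximum principle: let $v$ be continuous on $\overline\Omega_T$, $C^2$ in $x$ and differentiable in $t$ in $\Omega\times(0,T)$, with $\mathfrak Lv\le0$ in $\Omega\times(0,T)$; if $v\le M$ on $(\overline\Omega\times\{0\})\cup(\partial\Omega\times[0,T))$ for some constant $M\ge0$, then $v\le M$ on $\overline\Omega_T$. -/

import Mathlib

open Set Filter Topology
open scoped ContDiff

noncomputable section

namespace HypFlow

/-- Euclidean space `ℝⁿ`. -/
abbrev E (n : ℕ) := EuclideanSpace ℝ (Fin n)

/-! ### Spatial derivatives -/

/-- The Hessian matrix `(v_{ij}(x))` of `v`, computed within the set `S`. -/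
def hessWithin {n : ℕ} (v : E n → ℝ) (S : Set (E n)) (x : E n) : Matrix (Fin n) (Fin n) ℝ :=
  Matrix.of fun i j =>
    (fderivWithin ℝ (fun y => gradientWithin v S y) S x (EuclideanSpace.single j 1)) i

/-! ### Domains and the mean curvature of their boundary -/

/-- `ρ` is a smooth defining function of `Ω` near the boundary point `x`: near `x` the set `Ω` is
`{ρ < 0}`, and `∇ρ(x) ≠ 0`. -/
def IsLocalDefiningFunction {n : ℕ} (Ω : Set (E n)) (x : E n) (ρ : E n → ℝ) : Prop :=
  ∃ U : Set (E n), IsOpen U ∧ x ∈ U ∧ ContDiffOn ℝ ∞ ρ U ∧ (∀ y ∈ U, y ∈ Ω ↔ ρ y < 0) ∧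
    gradient ρ x ≠ 0

/-- A bounded smooth domain of `ℝⁿ`. -/
structure IsBoundedSmoothDomain {n : ℕ} (Ω : Set (E n)) : Prop where
  isOpen : IsOpen Ω
  isConnected : IsConnected Ω
  isBounded : Bornology.IsBounded Ω
  smooth_boundary : ∀ x ∈ frontier Ω, ∃ ρ : E n → ℝ, IsLocalDefiningFunction Ω x ρ

/-- The Euclidean mean curvature (average of the principal curvatures) at `x` of the level set of
`ρ` through `x`, that is `(n - 1)⁻¹ div (∇ρ / |∇ρ|)`, with the divergence written out:
`(|∇ρ|² Δρ - D²ρ(∇ρ, ∇ρ)) / |∇ρ|³`. It is positive for a sphere bounding the ball `{ρ < 0}`. -/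
def levelSetMeanCurvature {n : ℕ} (ρ : E n → ℝ) (x : E n) : ℝ :=
  let p : E n := gradient ρ x
  let H := hessWithin ρ univ x
  (‖p‖ ^ 2 * H.trace - ∑ i, ∑ j, H i j * p i * p j) / ‖p‖ ^ 3 / ((n : ℝ) - 1)

/-- The boundary of `Ω` has nonnegative mean curvature with respect to the interior normal. (The
value of the mean curvature does not depend on the defining function.) -/
def MeanConvexBoundary {n : ℕ} (Ω : Set (E n)) : Prop :=
  ∀ x ∈ frontier Ω, ∀ ρ : E n → ℝ, IsLocalDefiningFunction Ω x ρ → 0 ≤ levelSetMeanCurvature ρ x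

/-! ### The curvature function -/

/-- The structure conditions on the curvature function `f`, defined in the open symmetric convex
cone `K`. -/
structure IsCurvatureFunction {n : ℕ} (K : Set (Fin n → ℝ)) (f : (Fin n → ℝ) → ℝ) : Prop where
  isOpen : IsOpen K
  convex : Convex ℝ K
  cone : ∀ l ∈ K, ∀ c : ℝ, 0 < c → c • l ∈ K
  cone_symm : ∀ l ∈ K, ∀ π : Equiv.Perm (Fin n), l ∘ π ∈ K
  positive_cone_subset : {l : Fin n → ℝ | ∀ i, 0 < l i} ⊆ K
  contDiffOn : ContDiffOn ℝ 1 f K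
  continuousOn : ContinuousOn f (closure K)
  symm : ∀ l ∈ K, ∀ π : Equiv.Perm (Fin n), f (l ∘ π) = f l
  partial_pos : ∀ l ∈ K, ∀ i, 0 < fderiv ℝ f l (Pi.single i 1)
  concave : ConcaveOn ℝ K f
  pos : ∀ l ∈ K, 0 < f l
  zero_on_boundary : ∀ l ∈ frontier K, f l = 0
  normalized : f (fun _ => 1) = 1
  homogeneous : ∀ l ∈ K, ∀ c : ℝ, 0 < c → f (c • l) = c * f l

open Classical in
/-- The eigenvalues `λ(A)`, with multiplicity, of a symmetric real matrix (in some order). -/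
def eigs {n : ℕ} (A : Matrix (Fin n) (Fin n) ℝ) : Fin n → ℝ :=
  if hA : A.IsHermitian then hA.eigenvalues else 0

/-! ### Curvature of vertical graphs in the half-space model -/

/-- `w = √(1 + |p|²)`. -/
def slopeW {n : ℕ} (p : E n) : ℝ := Real.sqrt (1 + ‖p‖ ^ 2)

/-- `γ^{ij} = δ_{ij} - p_i p_j / (w (1 + w))`. -/
def gammaUp {n : ℕ} (p : E n) : Matrix (Fin n) (Fin n) ℝ :=
  Matrix.of fun i j => (if i = j then 1 else 0) - p i * p j / (slopeW p * (1 + slopeW p))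

/-- The matrix `a_{ij} = (δ_{ij} + z γ^{ik} r_{kl} γ^{lj}) / w`. At `r = D²v`, `p = Dv`, `z = v` its
eigenvalues are the hyperbolic principal curvatures of the graph of `v`, with respect to the
upward normal. -/
def curvMatrix {n : ℕ} (r : Matrix (Fin n) (Fin n) ℝ) (p : E n) (z : ℝ) :
    Matrix (Fin n) (Fin n) ℝ :=
  (slopeW p)⁻¹ • (1 + z • (gammaUp p * r * gammaUp p))

/-- The hyperbolic principal curvatures `κ[v]` of the graph of `v : Ω̄ → (0, ∞)` above `x`. -/
def kappa {n : ℕ} (Ω : Set (E n)) (v : E n → ℝ) (x : E n) : Fin n → ℝ :=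
  eigs (curvMatrix (hessWithin v (closure Ω) x) (gradientWithin v (closure Ω) x) (v x))

/-- The operator `G(r, p, z, τ) = τ / (z w) - F`, with `F = f(λ(A))`, `A = (a_{ij})`. -/
def opG {n : ℕ} (f : (Fin n → ℝ) → ℝ) (r : Matrix (Fin n) (Fin n) ℝ) (p : E n) (z τ : ℝ) : ℝ :=
  τ / (z * slopeW p) - f (eigs (curvMatrix r p z))

/-! ### Functions on the parabolic cylinder `Ω̄ × [0, T)` -/

/-- The time derivative on `[0, T)` (one-sided at `t = 0`). -/
def timeDeriv {n : ℕ} (T : ℝ) (u : E n → ℝ → ℝ) (x : E n) (t : ℝ) : ℝ :=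
  derivWithin (fun s => u x s) (Ico 0 T) t

/-- `Ω̄ × [0, T)`. -/
def closedCylinder {n : ℕ} (Ω : Set (E n)) (T : ℝ) : Set (E n × ℝ) := closure Ω ×ˢ Ico 0 T

/-- `Ω̄ × [0, T)` without the corner `∂Ω × {0}`. -/
def closedCylinderOffCorner {n : ℕ} (Ω : Set (E n)) (T : ℝ) : Set (E n × ℝ) :=
  {z | z ∈ closedCylinder Ω T ∧ (z.1 ∈ Ω ∨ 0 < z.2)}

/-- The class `C^{2,1}`: `u` and `Du` are continuous on `Ω̄ × [0, T)`; `D²u` and `u_t` exist and are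
continuous on `Ω̄ × [0, T)` except possibly at the corner `∂Ω × {0}`, near which `u_t` only has to
stay bounded. -/
structure IsC21 {n : ℕ} (Ω : Set (E n)) (T : ℝ) (u : E n → ℝ → ℝ) : Prop where
  continuousOn : ContinuousOn (fun z : E n × ℝ => u z.1 z.2) (closedCylinder Ω T)
  differentiableOn : ∀ t ∈ Ico 0 T, DifferentiableOn ℝ (fun y => u y t) (closure Ω)
  continuousOn_grad :
    ContinuousOn (fun z : E n × ℝ => gradientWithin (fun y => u y z.2) (closure Ω) z.1)
      (closedCylinder Ω T)
  differentiable_grad : ∀ z ∈ closedCylinderOffCorner Ω T,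
    DifferentiableWithinAt ℝ (fun y => gradientWithin (fun y' => u y' z.2) (closure Ω) y)
      (closure Ω) z.1
  continuousOn_hess :
    ContinuousOn (fun z : E n × ℝ => hessWithin (fun y => u y z.2) (closure Ω) z.1)
      (closedCylinderOffCorner Ω T)
  differentiable_time : ∀ z ∈ closedCylinderOffCorner Ω T,
    DifferentiableWithinAt ℝ (fun s => u z.1 s) (Ico 0 T) z.2
  continuousOn_timeDeriv :
    ContinuousOn (fun z : E n × ℝ => timeDeriv T u z.1 z.2) (closedCylinderOffCorner Ω T)
  bounded_timeDeriv : ∀ T' < T, ∃ C : ℝ, ∀ x ∈ Ω, ∀ t ∈ Icc 0 T', |timeDeriv T u x t| ≤ C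

/-- `u` is an admissible solution of the approximate problem
`u_t / (u w) - F = -σ` in `Ω × [0, T)`, `u = ε` on `∂Ω × [0, T)`, `u(·, 0) = u₀ + ε` in `Ω`:
it is of class `C^{2,1}` and positive, and `κ[u] ∈ K`. -/
structure IsAdmissibleSolution {n : ℕ} (K : Set (Fin n → ℝ)) (f : (Fin n → ℝ) → ℝ) (σ ε : ℝ)
    (Ω : Set (E n)) (T : ℝ) (u₀ : E n → ℝ) (u : E n → ℝ → ℝ) : Prop where
  isC21 : IsC21 Ω T u
  pos : ∀ x ∈ Ω, ∀ t ∈ Ico 0 T, 0 < u x t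
  admissible : ∀ x ∈ Ω, ∀ t ∈ Ico 0 T, kappa Ω (fun y => u y t) x ∈ K
  equation : ∀ x ∈ Ω, ∀ t ∈ Ico 0 T,
    opG f (hessWithin (fun y => u y t) (closure Ω) x)
      (gradientWithin (fun y => u y t) (closure Ω) x) (u x t) (timeDeriv T u x t) = -σ
  boundary : ∀ x ∈ frontier Ω, ∀ t ∈ Ico 0 T, u x t = ε
  initial : ∀ x ∈ Ω, u x 0 = u₀ x + ε

/-- `(𝔏 v)(x, t) = ℓ`, where `𝔏` is the linearized operator of `G` at `u`:
`𝔏 v = d/ds G(D²(u + s v), D(u + s v), u + s v, (u + s v)_t)` at `s = 0`. -/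
def LinearizedOpEq {n : ℕ} (f : (Fin n → ℝ) → ℝ) (Ω : Set (E n)) (T : ℝ) (u v : E n → ℝ → ℝ)
    (x : E n) (t ℓ : ℝ) : Prop :=
  HasDerivAt (fun s : ℝ => opG f
    (hessWithin (fun y => u y t) (closure Ω) x + s • hessWithin (fun y => v y t) (closure Ω) x)
    (gradientWithin (fun y => u y t) (closure Ω) x +
      s • gradientWithin (fun y => v y t) (closure Ω) x)
    (u x t + s * v x t) (timeDeriv T u x t + s * timeDeriv T v x t)) ℓ 0

/-- The (weak) maximum principle for the linearized operator `𝔏` of `G` at `u` in `Ω × (0, T)`: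
if `𝔏 v ≤ 0` and `v ≤ M` on the parabolic boundary, for a constant `M ≥ 0`, then `v ≤ M`
everywhere. -/
def LinearizedMaximumPrinciple {n : ℕ} (f : (Fin n → ℝ) → ℝ) (Ω : Set (E n)) (T : ℝ)
    (u : E n → ℝ → ℝ) : Prop :=
  ∀ v : E n → ℝ → ℝ,
    ContinuousOn (fun z : E n × ℝ => v z.1 z.2) (closedCylinder Ω T) →
    (∀ t ∈ Ioo 0 T, ContDiffOn ℝ 2 (fun y => v y t) Ω) →
    (∀ x ∈ Ω, ∀ t ∈ Ioo 0 T, DifferentiableAt ℝ (fun s => v x s) t) →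
    (∀ x ∈ Ω, ∀ t ∈ Ioo 0 T, ∃ ℓ ≤ 0, LinearizedOpEq f Ω T u v x t ℓ) →
    ∀ M : ℝ, 0 ≤ M →
      (∀ x ∈ closure Ω, v x 0 ≤ M) → (∀ x ∈ frontier Ω, ∀ t ∈ Ico 0 T, v x t ≤ M) →
      ∀ x ∈ closure Ω, ∀ t ∈ Ico 0 T, v x t ≤ M

end HypFlow

end

namespace HypFlow

open scoped Matrix

/-! The proof rests on a scaling identity. With slope and Hessian frozen, the curvatures at height
`z` are `(1 + z μᵢ) / w`, so those at height `z₁` arise from those at `z₂` by multiplying with `z₁ /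
z₂` and subtracting the constant `(z₁ - z₂) / (w z₂)`. Concavity and homogeneity make `f`
superadditive with `f (c, …, c) = c`; hence `F(z₁) ≤ (z₁ / z₂) F(z₂) - (z₁ - z₂) / (w z₂)` for `z₂ ≤
z₁` (`apply_eigs_height`). Together with monotonicity in the Hessian this gives `speed_comparison`,
a finite-difference substitute for differentiating the equation, which is not possible for a
solution assumed only `C^{2,1}`.

Curvature bound. By `comparison_principle` the flow stays below its initial graph, a stationary
supersolution because `F ≤ σ` there. Comparing `u` with its translates in time then gives `u_t ≤ 0`,
and the equation turns this into `F ≤ σ`. Since `F ≥ 1 > σ` at an interior minimum, `u ≥ ε` follows.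

Gradient bound. Suppose `|Du|` is maximal over space at a boundary point at a positive time. There
`u_t = 0`, so `F = σ` by continuity; the constancy of `u` on `∂Ω`, the maximality and mean convexity
force `tr (γ D²u γ) ≤ 0`. As `f` lies below the arithmetic mean, `σ ≤ 1 / w`. In the interior, the
growth rate of spatial difference quotients of `u` is controlled by `w σ - 1` (the sign of `u_t`
disposes of the other term), hence by the excess of `|Du|` over the critical slope, and an
exponential weight in time rules out a positive maximum of that excess.

Finally, `F ≤ σ ≤ 1 / w` and `u_t ≤ 0` in the height inequality give `G_u ≥ 0`. At a point where `v
- δ t` is maximal and `v > 0`, the Hessian and height contributions to `𝔏 v` are then nonnegative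
and the time contribution is positive, which contradicts `𝔏 v ≤ 0`. -/

/-! ### Eigenvalues of symmetric matrices: Weyl's inequality and continuity. -/

lemma isHermitian_iff_transpose {n : ℕ} {A : Matrix (Fin n) (Fin n) ℝ} :
    A.IsHermitian ↔ Aᵀ = A := by
  rw [Matrix.IsHermitian, Matrix.conjTranspose_eq_transpose_of_trivial]

lemma dotProduct_mulVec_comm {n : ℕ} {A : Matrix (Fin n) (Fin n) ℝ} (hA : A.IsHermitian)
    (x y : Fin n → ℝ) : x ⬝ᵥ A *ᵥ y = (A *ᵥ x) ⬝ᵥ y := by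
  rw [Matrix.dotProduct_mulVec, ← Matrix.mulVec_transpose, isHermitian_iff_transpose.1 hA]

lemma quadForm_eq_sum_eigenvalues {n : ℕ} {A : Matrix (Fin n) (Fin n) ℝ} (hA : A.IsHermitian)
    (x : E n) :
    x.ofLp ⬝ᵥ A *ᵥ x.ofLp = ∑ j, hA.eigenvalues j * inner ℝ (hA.eigenvectorBasis j) x ^ 2 := by
  have h1 : x.ofLp ⬝ᵥ A *ᵥ x.ofLp = inner ℝ x (WithLp.toLp 2 (A *ᵥ x.ofLp)) := by
    simp [EuclideanSpace.inner_eq_star_dotProduct, dotProduct_comm]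
  rw [h1, ← hA.eigenvectorBasis.sum_inner_mul_inner]
  refine Finset.sum_congr rfl fun j _ => ?_
  have h2 : inner ℝ (hA.eigenvectorBasis j) (WithLp.toLp 2 (A *ᵥ x.ofLp)) =
      hA.eigenvalues j * inner ℝ (hA.eigenvectorBasis j) x := by
    have h3 := dotProduct_mulVec_comm hA (hA.eigenvectorBasis j).ofLp x.ofLp
    rw [hA.mulVec_eigenvectorBasis] at h3
    simp only [EuclideanSpace.inner_eq_star_dotProduct, star_trivial]
    rw [dotProduct_comm, h3, smul_dotProduct, smul_eq_mul, dotProduct_comm]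
  rw [h2, real_inner_comm]; ring

lemma inner_eq_zero_of_mem_span {n : ℕ} {ι : Type*} [Fintype ι] (b : OrthonormalBasis ι ℝ (E n))
    (s : Set ι) {x : E n} (hx : x ∈ Submodule.span ℝ (b '' s)) {j : ι} (hj : j ∉ s) :
    inner ℝ (b j) x = 0 := by
  induction hx using Submodule.span_induction with
  | mem x h =>
    obtain ⟨i, hi, rfl⟩ := h
    exact b.orthonormal.2 (fun h => hj (h ▸ hi))
  | zero => simp
  | add x y _ _ hx hy => rw [inner_add_right, hx, hy, add_zero]
  | smul a x _ hx => rw [inner_smul_right, hx, mul_zero]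

/-- A one-sided form of Weyl's inequality. -/
theorem eigenvalues_le_of_quadForm_le {n : ℕ} {A B : Matrix (Fin n) (Fin n) ℝ}
    (hA : A.IsHermitian) (hB : B.IsHermitian) {a c : ℝ} (ha : 0 ≤ a)
    (h : ∀ x : Fin n → ℝ, x ⬝ᵥ A *ᵥ x ≤ a * (x ⬝ᵥ B *ᵥ x) + c * (x ⬝ᵥ x)) (i : Fin n) :
    hA.eigenvalues i ≤ a * hB.eigenvalues i + c := by
  -- This is the enumeration through which `eigenvalues` is built from the decreasing family
  -- `eigenvalues₀`, the same for `A` and `B`. Thus `I` indexes eigenvalues of `A` that are at least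
  -- the `i`-th and `J` those of `B` that are at most the `i`-th.
  set e : Fin (Fintype.card (Fin n)) ≃ Fin n := Fintype.equivOfCardEq (Fintype.card_fin _) with he
  set I : Finset (Fin n) := Finset.univ.filter fun j => e.symm j ≤ e.symm i
  set J : Finset (Fin n) := Finset.univ.filter fun j => e.symm i ≤ e.symm j
  have hcard : n < I.card + J.card := by
    have hU : I ∪ J = Finset.univ := by
      ext j; simp [I, J, le_total]
    have hne : 0 < (I ∩ J).card := Finset.card_pos.2 ⟨i, by simp [I, J]⟩
    have := Finset.card_union_add_card_inter I J
    rw [hU, Finset.card_univ, Fintype.card_fin] at this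
    omega
  have hfin : ∀ (b : OrthonormalBasis (Fin n) ℝ (E n)) (s : Finset (Fin n)),
      Module.finrank ℝ (Submodule.span ℝ (b '' (s : Set (Fin n)))) = s.card := by
    intro b s
    have hl : LinearIndependent ℝ (fun j : s => b j) :=
      b.orthonormal.linearIndependent.comp _ Subtype.val_injective
    have := finrank_span_eq_card hl
    rw [Fintype.card_coe] at this
    rw [← this, Set.image_eq_range]
    rfl
  -- The two spans have dimensions adding up to more than `n`, so they share a nonzero vector, on
  -- which both quadratic forms are controlled by the `i`-th eigenvalues.
  obtain ⟨x, hx, hx0⟩ : ∃ x ∈ Submodule.span ℝ (hA.eigenvectorBasis '' (I : Set (Fin n))) ⊓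
      Submodule.span ℝ (hB.eigenvectorBasis '' (J : Set (Fin n))), x ≠ 0 := by
    by_contra! hcon
    have hbot := (Submodule.eq_bot_iff _).2 hcon
    have := Submodule.finrank_add_finrank_le_of_disjoint (disjoint_iff.2 hbot)
    rw [hfin, hfin, finrank_euclideanSpace, Fintype.card_fin] at this
    omega
  have hxx : x.ofLp ⬝ᵥ x.ofLp = ‖x‖ ^ 2 := by
    rw [← real_inner_self_eq_norm_sq, EuclideanSpace.inner_eq_star_dotProduct]; rfl
  have hpos : 0 < ‖x‖ ^ 2 := by positivity
  have hsum : ∀ b : OrthonormalBasis (Fin n) ℝ (E n), ∑ j, inner ℝ (b j) x ^ 2 = ‖x‖ ^ 2 := by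
    intro b
    rw [← real_inner_self_eq_norm_sq, ← b.sum_inner_mul_inner]
    exact Finset.sum_congr rfl fun j _ => by rw [real_inner_comm (b j) x]; ring
  have hlow : hA.eigenvalues i * ‖x‖ ^ 2 ≤ x.ofLp ⬝ᵥ A *ᵥ x.ofLp := by
    rw [quadForm_eq_sum_eigenvalues hA, ← hsum hA.eigenvectorBasis, Finset.mul_sum]
    refine Finset.sum_le_sum fun j _ => ?_
    by_cases hj : j ∈ I
    · exact mul_le_mul_of_nonneg_right
        (hA.eigenvalues₀_antitone (by simpa [I] using hj)) (sq_nonneg _)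
    · rw [inner_eq_zero_of_mem_span _ _ hx.1 (by simpa using hj)]; simp
  have hup : x.ofLp ⬝ᵥ B *ᵥ x.ofLp ≤ hB.eigenvalues i * ‖x‖ ^ 2 := by
    rw [quadForm_eq_sum_eigenvalues hB, ← hsum hB.eigenvectorBasis, Finset.mul_sum]
    refine Finset.sum_le_sum fun j _ => ?_
    by_cases hj : j ∈ J
    · exact mul_le_mul_of_nonneg_right
        (hB.eigenvalues₀_antitone (by simpa [J] using hj)) (sq_nonneg _)
    · rw [inner_eq_zero_of_mem_span _ _ hx.2 (by simpa using hj)]; simp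
  have h1 := h x.ofLp
  rw [hxx] at h1
  have h2 := mul_le_mul_of_nonneg_left hup ha
  nlinarith

lemma eigs_of_isHermitian {n : ℕ} {A : Matrix (Fin n) (Fin n) ℝ} (hA : A.IsHermitian) :
    eigs A = hA.eigenvalues := by
  rw [eigs, dif_pos hA]

lemma eigs_le_of_quadForm_le {n : ℕ} {A B : Matrix (Fin n) (Fin n) ℝ}
    (hA : A.IsHermitian) (hB : B.IsHermitian)
    (h : ∀ x : Fin n → ℝ, x ⬝ᵥ A *ᵥ x ≤ x ⬝ᵥ B *ᵥ x) (i : Fin n) : eigs A i ≤ eigs B i := by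
  rw [eigs_of_isHermitian hA, eigs_of_isHermitian hB]
  have := eigenvalues_le_of_quadForm_le hA hB (a := 1) (c := 0) zero_le_one
    (fun x => by simpa using h x) i
  simpa using this

lemma isHermitian_affine {n : ℕ} {S : Matrix (Fin n) (Fin n) ℝ} (hS : S.IsHermitian) (a b : ℝ) :
    (b • (1 + a • S)).IsHermitian := by
  rw [isHermitian_iff_transpose] at *
  simp [hS]

/-- The eigenvalues of `b (1 + a S)` in terms of those of `S`. -/
lemma eigs_affine {n : ℕ} {S : Matrix (Fin n) (Fin n) ℝ} (hS : S.IsHermitian) {a b : ℝ}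
    (ha : 0 < a) (hb : 0 < b) : eigs (b • (1 + a • S)) = fun i => b * (1 + a * eigs S i) := by
  have hA := isHermitian_affine hS a b
  rw [eigs_of_isHermitian hA, eigs_of_isHermitian hS]
  have hq : ∀ x : Fin n → ℝ, x ⬝ᵥ (b • (1 + a • S)) *ᵥ x = b * a * (x ⬝ᵥ S *ᵥ x) + b * (x ⬝ᵥ x) := by
    intro x
    simp only [Matrix.smul_mulVec, Matrix.add_mulVec, Matrix.one_mulVec, dotProduct_smul,
      dotProduct_add, smul_eq_mul]
    ring
  ext i
  apply le_antisymm
  · have := eigenvalues_le_of_quadForm_le hA hS (a := b * a) (c := b) (by positivity)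
      (fun x => (hq x).le) i
    linarith
  -- The constants invert the affine map: `S = (b a)⁻¹ (b (1 + a S)) - a⁻¹`.
  · have := eigenvalues_le_of_quadForm_le hS hA (a := (b * a)⁻¹) (c := -a⁻¹) (by positivity)
      (fun x => by rw [hq x]; field_simp; simp) i
    have h2 := mul_le_mul_of_nonneg_left this (by positivity : 0 ≤ b * a)
    field_simp at h2
    linarith

lemma sum_eigs_eq_trace {n : ℕ} {A : Matrix (Fin n) (Fin n) ℝ} (hA : A.IsHermitian) :
    ∑ i, eigs A i = A.trace := by
  rw [eigs_of_isHermitian hA, hA.trace_eq_sum_eigenvalues]; simp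

lemma quadForm_le_sum_abs {n : ℕ} (A : Matrix (Fin n) (Fin n) ℝ) (x : Fin n → ℝ) :
    x ⬝ᵥ A *ᵥ x ≤ (∑ i, ∑ j, |A i j|) * (x ⬝ᵥ x) := by
  have hx : ∀ i, x i ^ 2 ≤ x ⬝ᵥ x := fun i => by
    rw [dotProduct, sq]
    exact Finset.single_le_sum (f := fun i => x i * x i) (fun j _ => mul_self_nonneg _)
      (Finset.mem_univ i)
  have hq : x ⬝ᵥ A *ᵥ x = ∑ i, ∑ j, x i * (A i j * x j) :=
    Finset.sum_congr rfl fun i _ => by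
      change x i * (∑ j, A i j * x j) = _
      rw [Finset.mul_sum]
  rw [hq, Finset.sum_mul]
  refine Finset.sum_le_sum fun i _ => ?_
  rw [Finset.sum_mul]
  refine Finset.sum_le_sum fun j _ => ?_
  calc x i * (A i j * x j) ≤ |x i * (A i j * x j)| := le_abs_self _
    _ = |A i j| * (|x i| * |x j|) := by rw [abs_mul, abs_mul]; ring
    _ ≤ |A i j| * (x ⬝ᵥ x) := by
      refine mul_le_mul_of_nonneg_left ?_ (abs_nonneg _)
      have h1 := hx i
      have h2 := hx j
      rw [← sq_abs] at h1 h2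
      nlinarith [sq_nonneg (|x i| - |x j|)]

/-- Weyl's inequality in both directions, with the form of `A - B` bounded by its entries, makes the
ordered eigenvalues Lipschitz in the entries. -/
lemma abs_eigs_sub_le {n : ℕ} {A B : Matrix (Fin n) (Fin n) ℝ}
    (hA : A.IsHermitian) (hB : B.IsHermitian) (i : Fin n) :
    |eigs A i - eigs B i| ≤ ∑ i, ∑ j, |A i j - B i j| := by
  rw [eigs_of_isHermitian hA, eigs_of_isHermitian hB]
  have key : ∀ {A B : Matrix (Fin n) (Fin n) ℝ} (hA : A.IsHermitian) (hB : B.IsHermitian),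
      hA.eigenvalues i ≤ 1 * hB.eigenvalues i + ∑ i, ∑ j, |A i j - B i j| := by
    intro A B hA hB
    refine eigenvalues_le_of_quadForm_le hA hB zero_le_one (fun x => ?_) i
    have := quadForm_le_sum_abs (A - B) x
    simp only [Matrix.sub_mulVec, dotProduct_sub, Matrix.sub_apply] at this
    linarith
  have h1 := key hA hB
  have h2 := key hB hA
  simp only [abs_sub_comm (B _ _)] at h2
  rw [abs_le]
  constructor <;> linarith

/-- The eigenvalues of symmetric matrices depend continuously on the matrix. -/
lemma tendsto_eigs {n : ℕ} {α : Type*} {l : Filter α} {A : α → Matrix (Fin n) (Fin n) ℝ}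
    {B : Matrix (Fin n) (Fin n) ℝ} (hA : ∀ᶠ y in l, (A y).IsHermitian) (hB : B.IsHermitian)
    (h : Tendsto A l (𝓝 B)) : Tendsto (fun y => eigs (A y)) l (𝓝 (eigs B)) := by
  rw [tendsto_pi_nhds]
  intro i
  rw [tendsto_iff_norm_sub_tendsto_zero]
  have h0 : Tendsto (fun y => ∑ i, ∑ j, |A y i j - B i j|) l (𝓝 0) := by
    have : (0 : ℝ) = ∑ i : Fin n, ∑ j : Fin n, |B i j - B i j| := by simp
    rw [this]
    refine tendsto_finsetSum _ fun i _ => tendsto_finsetSum _ fun j _ => ?_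
    have h1 : Tendsto (fun y => A y i j) l (𝓝 (B i j)) := by
      have := (tendsto_pi_nhds.1 ((tendsto_pi_nhds.1 h) i)) j
      exact this
    exact (h1.sub_const _).abs
  refine squeeze_zero' (Eventually.of_forall fun _ => norm_nonneg _) ?_ h0
  filter_upwards [hA] with y hy
  exact abs_eigs_sub_le hy hB i

lemma isHermitian_of_tendsto {n : ℕ} {α : Type*} {l : Filter α} [l.NeBot]
    {A : α → Matrix (Fin n) (Fin n) ℝ} {B : Matrix (Fin n) (Fin n) ℝ}
    (hA : ∀ᶠ y in l, (A y).IsHermitian) (h : Tendsto A l (𝓝 B)) : B.IsHermitian := by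
  rw [isHermitian_iff_transpose]
  have h1 : Tendsto (fun y => (A y)ᵀ) l (𝓝 Bᵀ) :=
    ((continuous_id.matrix_transpose).tendsto B).comp h
  refine tendsto_nhds_unique h1 (h.congr' ?_)
  filter_upwards [hA] with y hy
  exact (isHermitian_iff_transpose.1 hy).symm

lemma hasDerivAt_nonneg_of_eventually_le_right {g : ℝ → ℝ} {d x : ℝ} (h : HasDerivAt g d x)
    (hg : ∀ᶠ y in 𝓝[>] x, g x ≤ g y) : 0 ≤ d := by
  have h1 : Tendsto (slope g x) (𝓝[>] x) (𝓝 d) := (hasDerivAt_iff_tendsto_slope.1 h).mono_left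
    (nhdsWithin_mono x (fun y (hy : x < y) => hy.ne'))
  refine ge_of_tendsto h1 ?_
  filter_upwards [hg, self_mem_nhdsWithin] with y hy (hxy : x < y)
  rw [slope_def_field]
  exact div_nonneg (sub_nonneg.2 hy) (sub_nonneg.2 hxy.le)

lemma hasDerivAt_nonneg_of_eventually_le_left {g : ℝ → ℝ} {d x : ℝ} (h : HasDerivAt g d x)
    (hg : ∀ᶠ y in 𝓝[<] x, g y ≤ g x) : 0 ≤ d := by
  have h1 : Tendsto (slope g x) (𝓝[<] x) (𝓝 d) := (hasDerivAt_iff_tendsto_slope.1 h).mono_left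
    (nhdsWithin_mono x (fun y (hy : y < x) => hy.ne))
  refine ge_of_tendsto h1 ?_
  filter_upwards [hg, self_mem_nhdsWithin] with y hy (hxy : y < x)
  rw [slope_def_field]
  exact div_nonneg_of_nonpos (sub_nonpos.2 hy) (sub_nonpos.2 hxy.le)

/-! ### Consequences of the structure conditions on `f`. -/

namespace IsCurvatureFunction

variable {n : ℕ} {K : Set (Fin n → ℝ)} {f : (Fin n → ℝ) → ℝ}

/-- Homogeneity forces `f 0 = 2 f 0`, against positivity. -/
lemma zero_notMem (hf : IsCurvatureFunction K f) : (0 : Fin n → ℝ) ∉ K := by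
  intro h
  have h1 := hf.homogeneous 0 h 2 two_pos
  have h2 := hf.pos 0 h
  rw [smul_zero] at h1
  linarith

lemma add_mem (hf : IsCurvatureFunction K f) {a b : Fin n → ℝ} (ha : a ∈ K) (hb : b ∈ K) :
    a + b ∈ K := by
  have h := hf.cone _ (hf.convex ha hb (by norm_num : (0 : ℝ) ≤ 1 / 2)
    (by norm_num : (0 : ℝ) ≤ 1 / 2) (by norm_num)) 2 two_pos
  convert h using 1
  ext i; simp; ring

/-- Concavity at the midpoint, doubled by homogeneity. -/
lemma add_le (hf : IsCurvatureFunction K f) {a b : Fin n → ℝ} (ha : a ∈ K) (hb : b ∈ K) :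
    f a + f b ≤ f (a + b) := by
  have h := hf.concave.2 ha hb (by norm_num : (0 : ℝ) ≤ 1 / 2)
    (by norm_num : (0 : ℝ) ≤ 1 / 2) (by norm_num)
  have hm := hf.convex ha hb (by norm_num : (0 : ℝ) ≤ 1 / 2)
    (by norm_num : (0 : ℝ) ≤ 1 / 2) (by norm_num)
  have h2 := hf.homogeneous _ hm 2 two_pos
  have h3 : (2 : ℝ) • ((1 / 2 : ℝ) • a + (1 / 2 : ℝ) • b) = a + b := by
    ext i; simp; ring
  rw [h3] at h2
  simp only [smul_eq_mul] at h
  linarith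

lemma const_mem (hf : IsCurvatureFunction K f) {c : ℝ} (hc : 0 < c) :
    (fun _ : Fin n => c) ∈ K :=
  hf.positive_cone_subset fun _ => hc

lemma apply_const (hf : IsCurvatureFunction K f) {c : ℝ} (hc : 0 < c) :
    f (fun _ => c) = c := by
  have h := hf.homogeneous _ (hf.const_mem one_pos) c hc
  rw [hf.normalized, mul_one] at h
  refine Eq.trans ?_ h
  congr 1
  ext i; simp

lemma eventually_sub_const_mem (hf : IsCurvatureFunction K f) {a : Fin n → ℝ} (ha : a ∈ K) :
    Tendsto (fun η : ℝ => fun i => a i - η) (𝓝[>] 0) (𝓝 a) ∧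
      ∀ᶠ η : ℝ in 𝓝[>] 0, (fun i => a i - η) ∈ K := by
  have h : Tendsto (fun η : ℝ => fun i => a i - η) (𝓝[>] 0) (𝓝 a) := by
    have hc : Continuous (fun η : ℝ => fun i => a i - η) := by fun_prop
    have := (hc.tendsto 0).mono_left (nhdsWithin_le_nhds (s := Ioi 0))
    simpa using this
  exact ⟨h, h (hf.isOpen.mem_nhds ha)⟩

/-- The difference `b - a` need not lie in the open positive cone. Lowering `a` by a small `η` keeps
it in the open set `K` and makes the difference positive; superadditivity applies, and `η → 0`
removes the loss. -/
lemma mem_and_le_of_le (hf : IsCurvatureFunction K f) {a b : Fin n → ℝ} (ha : a ∈ K)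
    (hab : ∀ i, a i ≤ b i) : b ∈ K ∧ f a ≤ f b := by
  obtain ⟨h1, h2⟩ := hf.eventually_sub_const_mem ha
  have key : ∀ η : ℝ, 0 < η → (fun i => a i - η) ∈ K → b ∈ K ∧ f (fun i => a i - η) ≤ f b := by
    intro η hη hm
    have hp : (fun i => b i - a i + η) ∈ K := hf.positive_cone_subset fun i => by
      have := hab i
      linarith
    have hs : (fun i => a i - η) + (fun i => b i - a i + η) = b := by
      ext i; simp
    have hle := hf.add_le hm hp
    have hmem := hf.add_mem hm hp
    rw [hs] at hle hmem
    exact ⟨hmem, by linarith [hf.pos _ hp]⟩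
  constructor
  · obtain ⟨η, hη, hη'⟩ := (h2.and self_mem_nhdsWithin).exists
    exact (key η hη' hη).1
  · have hc : Tendsto (fun η : ℝ => f (fun i => a i - η)) (𝓝[>] 0) (𝓝 (f a)) :=
      ((hf.contDiffOn.continuousOn.continuousAt (hf.isOpen.mem_nhds ha)).tendsto).comp h1
    refine le_of_tendsto hc ?_
    filter_upwards [h2, self_mem_nhdsWithin] with η hη hη'
    exact (key η hη' hη).2

/-- Superadditivity against a constant vector; this plays the role of `∑ fᵢ ≥ 1`. -/
lemma add_const_le (hf : IsCurvatureFunction K f) {a : Fin n → ℝ} (ha : a ∈ K) {c : ℝ}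
    (hc : 0 ≤ c) : f a + c ≤ f (fun i => a i + c) := by
  rcases hc.eq_or_lt with rfl | hc
  · simp
  · have := hf.add_le ha (hf.const_mem hc)
    rw [hf.apply_const hc] at this
    exact this

/-- A concave symmetric function of degree one lies below the arithmetic mean. -/
lemma le_mean (hf : IsCurvatureFunction K f) (hn : 1 ≤ n) {a : Fin n → ℝ} (ha : a ∈ K) :
    f a ≤ (∑ i, a i) / n := by
  set N : ℝ := (Fintype.card (Equiv.Perm (Fin n)) : ℝ)
  have hN : 0 < N := by
    have : 0 < Fintype.card (Equiv.Perm (Fin n)) := Fintype.card_pos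
    exact Nat.cast_pos.2 this
  have hn' : (0 : ℝ) < n := by exact_mod_cast hn
  set m : ℝ := (∑ i, a i) / n
  -- Averaging `a` over all permutations of its entries gives the constant vector of its mean;
  -- symmetry of `f` and Jensen's inequality then compare `f a` with the value there.
  have hmean : ∑ π : Equiv.Perm (Fin n), N⁻¹ • (a ∘ π) = fun _ => m := by
    have hconst : ∀ i j : Fin n, ∑ π : Equiv.Perm (Fin n), a (π i) =
        ∑ π : Equiv.Perm (Fin n), a (π j) := by
      intro i j
      refine Fintype.sum_equiv (Equiv.mulRight (Equiv.swap i j)) _ _ fun π => ?_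
      simp
    ext i
    have h1 : ∑ j : Fin n, ∑ π : Equiv.Perm (Fin n), a (π j) = N * ∑ j, a j := by
      rw [Finset.sum_comm]
      rw [Finset.sum_congr rfl fun π _ => Equiv.sum_comp π a]
      simp [N]
    rw [Finset.sum_congr rfl fun j _ => hconst j i] at h1
    simp only [Finset.sum_const, Finset.card_univ, Fintype.card_fin, nsmul_eq_mul] at h1
    simp only [Finset.sum_apply, Pi.smul_apply, Function.comp_apply, smul_eq_mul]
    rw [← Finset.mul_sum]
    simp only [m]
    field_simp
    linarith
  have hw : ∑ _π : Equiv.Perm (Fin n), N⁻¹ = 1 := by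
    simp [N]
  have hmem : (fun _ => m) ∈ K := by
    rw [← hmean]
    exact hf.convex.sum_mem (fun _ _ => by positivity) hw fun π _ => hf.cone_symm a ha π
  have hle := hf.concave.le_map_sum (t := Finset.univ) (w := fun _ : Equiv.Perm (Fin n) => N⁻¹)
    (p := fun π : Equiv.Perm (Fin n) => a ∘ π)
    (fun _ _ => by positivity) hw fun π _ => hf.cone_symm a ha π
  rw [hmean] at hle
  have hleft : ∑ π : Equiv.Perm (Fin n), N⁻¹ • f (a ∘ π) = f a := by
    rw [Finset.sum_congr rfl fun π _ => by rw [hf.symm a ha π], ← Finset.sum_smul, hw, one_smul]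
  rw [hleft] at hle
  -- If `m ≤ 0`, adding the constant `-m` when it is positive would place the zero vector in `K`.
  have hm : 0 < m := by
    by_contra! hm
    refine hf.zero_notMem ?_
    rcases hm.eq_or_lt with h | h
    · rw [h] at hmem; exact hmem
    · have := hf.add_mem hmem (hf.const_mem (neg_pos.2 h))
      convert this using 1
      ext i; simp
  rwa [hf.apply_const hm] at hle

/-- The default value of `eigs` on a nonsymmetric matrix is zero, which is not in `K`; admissibility
therefore carries the symmetry of the curvature matrix with it. -/
lemma isHermitian_of_eigs_mem (hf : IsCurvatureFunction K f) {A : Matrix (Fin n) (Fin n) ℝ}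
    (h : eigs A ∈ K) : A.IsHermitian := by
  by_contra hA
  rw [eigs, dif_neg hA] at h
  exact hf.zero_notMem h

end IsCurvatureFunction

/-! ### Dependence of the curvature operator on Hessian and height. -/

variable {n : ℕ} {K : Set (Fin n → ℝ)} {f : (Fin n → ℝ) → ℝ}

lemma one_le_slopeW (p : E n) : 1 ≤ slopeW p := by
  rw [slopeW, Real.one_le_sqrt]; nlinarith [sq_nonneg ‖p‖]

lemma slopeW_pos (p : E n) : 0 < slopeW p := one_pos.trans_le (one_le_slopeW p)

lemma slopeW_sq (p : E n) : slopeW p ^ 2 = 1 + ‖p‖ ^ 2 := Real.sq_sqrt (by positivity)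

lemma transpose_gammaUp (p : E n) : (gammaUp p)ᵀ = gammaUp p := by
  ext i j
  simp only [gammaUp, Matrix.transpose_apply, Matrix.of_apply, eq_comm (a := j) (b := i)]
  ring

lemma quadForm_conj (g r : Matrix (Fin n) (Fin n) ℝ) (hg : gᵀ = g) (x : Fin n → ℝ) :
    x ⬝ᵥ (g * r * g) *ᵥ x = (g *ᵥ x) ⬝ᵥ r *ᵥ (g *ᵥ x) := by
  rw [← Matrix.mulVec_mulVec, ← Matrix.mulVec_mulVec, Matrix.dotProduct_mulVec,
    ← Matrix.mulVec_transpose, hg]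

lemma quadForm_curvMatrix (r : Matrix (Fin n) (Fin n) ℝ) (p : E n) (z : ℝ) (x : Fin n → ℝ) :
    x ⬝ᵥ curvMatrix r p z *ᵥ x = (slopeW p)⁻¹ * (x ⬝ᵥ x +
      z * ((gammaUp p *ᵥ x) ⬝ᵥ r *ᵥ (gammaUp p *ᵥ x))) := by
  rw [← quadForm_conj _ _ (transpose_gammaUp p), curvMatrix]
  simp only [Matrix.smul_mulVec, Matrix.add_mulVec, Matrix.one_mulVec, dotProduct_smul,
    dotProduct_add, smul_eq_mul]

/-- This lets `eigs_affine` be applied at admissible points, including boundary points, without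
discussing the symmetry of the one-sided Hessian itself. -/
lemma isHermitian_conj_of_isHermitian_curvMatrix {r : Matrix (Fin n) (Fin n) ℝ} {p : E n} {z : ℝ}
    (hz : z ≠ 0) (h : (curvMatrix r p z).IsHermitian) :
    (gammaUp p * r * gammaUp p).IsHermitian := by
  rw [isHermitian_iff_transpose, curvMatrix, Matrix.transpose_smul, Matrix.transpose_add,
    Matrix.transpose_one, Matrix.transpose_smul] at h
  rw [isHermitian_iff_transpose]
  have hw := inv_ne_zero (slopeW_pos p).ne'
  exact smul_right_injective _ hz (add_left_cancel (smul_right_injective _ hw h))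

lemma isHermitian_conj {r : Matrix (Fin n) (Fin n) ℝ} (hr : r.IsHermitian) (p : E n) :
    (gammaUp p * r * gammaUp p).IsHermitian := by
  rw [isHermitian_iff_transpose] at *
  rw [Matrix.transpose_mul, Matrix.transpose_mul, hr, transpose_gammaUp, Matrix.mul_assoc]

/-- Change of `F` under a change of height, the other arguments being fixed. -/
lemma IsCurvatureFunction.apply_eigs_height (hf : IsCurvatureFunction K f)
    {r : Matrix (Fin n) (Fin n) ℝ} {p : E n} {z₁ z₂ : ℝ} (hz₂ : 0 < z₂) (hz : z₂ ≤ z₁)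
    (hS : (gammaUp p * r * gammaUp p).IsHermitian) (h₁ : eigs (curvMatrix r p z₁) ∈ K) :
    f (eigs (curvMatrix r p z₁)) ≤
      z₁ / z₂ * f (eigs (curvMatrix r p z₂)) - (z₁ - z₂) / (slopeW p * z₂) := by
  have hw := slopeW_pos p
  have hz₁ : 0 < z₁ := hz₂.trans_le hz
  have e1 := eigs_affine hS hz₁ (inv_pos.2 hw)
  have e2 := eigs_affine hS hz₂ (inv_pos.2 hw)
  change eigs (curvMatrix r p z₁) = _ at e1
  change eigs (curvMatrix r p z₂) = _ at e2
  have hc : 0 < z₂ / z₁ := by positivity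
  have h1 := hf.homogeneous _ h₁ _ hc
  have h2 := hf.cone _ h₁ _ hc
  have h3 := hf.add_const_le h2 (c := (z₁ - z₂) / (slopeW p * z₁))
    (div_nonneg (sub_nonneg.2 hz) (by positivity))
  -- The scaling identity: shrinking the curvatures at `z₁` by `z₂ / z₁` and adding a constant gives
  -- exactly those at `z₂`.
  have h4 : (fun i => ((z₂ / z₁) • eigs (curvMatrix r p z₁)) i + (z₁ - z₂) / (slopeW p * z₁)) =
      eigs (curvMatrix r p z₂) := by
    ext i
    rw [Pi.smul_apply, e1, e2, smul_eq_mul]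
    field_simp
    ring
  rw [h4, h1] at h3
  have h5 := mul_le_mul_of_nonneg_left h3 (by positivity : 0 ≤ z₁ / z₂)
  have h6 : z₁ / z₂ * (z₂ / z₁ * f (eigs (curvMatrix r p z₁)) + (z₁ - z₂) / (slopeW p * z₁)) =
      f (eigs (curvMatrix r p z₁)) + (z₁ - z₂) / (slopeW p * z₂) := by
    field_simp
  linarith

lemma quadForm_curvMatrix_mono {r₁ r₂ : Matrix (Fin n) (Fin n) ℝ} (p : E n) {z : ℝ} (hz : 0 ≤ z)
    (hr : ∀ x : Fin n → ℝ, x ⬝ᵥ r₁ *ᵥ x ≤ x ⬝ᵥ r₂ *ᵥ x) (x : Fin n → ℝ) :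
    x ⬝ᵥ curvMatrix r₁ p z *ᵥ x ≤ x ⬝ᵥ curvMatrix r₂ p z *ᵥ x := by
  rw [quadForm_curvMatrix, quadForm_curvMatrix]
  have := hr (gammaUp p *ᵥ x)
  have hw := inv_pos.2 (slopeW_pos p)
  gcongr

/-- Monotonicity of `F` in the Hessian. -/
lemma IsCurvatureFunction.apply_eigs_mono (hf : IsCurvatureFunction K f)
    {r₁ r₂ : Matrix (Fin n) (Fin n) ℝ} {p : E n} {z : ℝ} (hz : 0 ≤ z)
    (hr : ∀ x : Fin n → ℝ, x ⬝ᵥ r₁ *ᵥ x ≤ x ⬝ᵥ r₂ *ᵥ x)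
    (hS : (gammaUp p * r₂ * gammaUp p).IsHermitian) (h₁ : eigs (curvMatrix r₁ p z) ∈ K) :
    eigs (curvMatrix r₂ p z) ∈ K ∧
      f (eigs (curvMatrix r₁ p z)) ≤ f (eigs (curvMatrix r₂ p z)) :=
  hf.mem_and_le_of_le h₁ (eigs_le_of_quadForm_le (hf.isHermitian_of_eigs_mem h₁)
    (isHermitian_affine hS _ _) (quadForm_curvMatrix_mono p hz hr))

/-- Comparison of the speeds of two graphs at a contact point of their gradients. -/
theorem IsCurvatureFunction.speed_comparison (hf : IsCurvatureFunction K f)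
    {r₁ r₂ : Matrix (Fin n) (Fin n) ℝ} {p : E n} {z₁ z₂ σ τ₁ τ₂ : ℝ} (hz₂ : 0 < z₂)
    (hz : z₂ ≤ z₁) (hr : ∀ x : Fin n → ℝ, x ⬝ᵥ r₁ *ᵥ x ≤ x ⬝ᵥ r₂ *ᵥ x)
    (h₁ : eigs (curvMatrix r₁ p z₁) ∈ K) (h₂ : eigs (curvMatrix r₂ p z₂) ∈ K)
    (e₁ : τ₁ = z₁ * slopeW p * (f (eigs (curvMatrix r₁ p z₁)) - σ))
    (e₂ : z₂ * slopeW p * (f (eigs (curvMatrix r₂ p z₂)) - σ) ≤ τ₂) :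
    τ₁ ≤ (z₁ / z₂) ^ 2 * τ₂ + z₁ / z₂ * (z₁ - z₂) * (slopeW p * σ - 1) := by
  have hw := slopeW_pos p
  have hz₁ : 0 < z₁ := hz₂.trans_le hz
  have hS := isHermitian_conj_of_isHermitian_curvMatrix hz₂.ne' (hf.isHermitian_of_eigs_mem h₂)
  -- The data are changed in two moves: first the Hessian from `r₁` to `r₂` at height `z₁`, then the
  -- height from `z₁` to `z₂`.
  obtain ⟨hm, hle⟩ := hf.apply_eigs_mono hz₁.le hr hS h₁
  have hh := hf.apply_eigs_height hz₂ hz hS hm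
  set F₁ := f (eigs (curvMatrix r₁ p z₁))
  set F₂ := f (eigs (curvMatrix r₂ p z₂))
  have h3 : F₂ ≤ τ₂ / (z₂ * slopeW p) + σ := by
    have : F₂ - σ ≤ τ₂ / (z₂ * slopeW p) := by
      rw [le_div_iff₀ (by positivity)]; linarith
    linarith
  have h4 : F₁ ≤ z₁ / z₂ * (τ₂ / (z₂ * slopeW p) + σ) - (z₁ - z₂) / (slopeW p * z₂) := by
    have := mul_le_mul_of_nonneg_left h3 (by positivity : 0 ≤ z₁ / z₂)
    linarith
  have h5 : τ₁ ≤ z₁ * slopeW p * (z₁ / z₂ * (τ₂ / (z₂ * slopeW p) + σ) -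
      (z₁ - z₂) / (slopeW p * z₂) - σ) := by
    rw [e₁]
    gcongr
  refine h5.trans (le_of_eq ?_)
  field_simp
  ring

/-- `G_u` exists, and it is nonnegative where `u_t ≤ 0` and `F ≤ σ ≤ 1 / w`. -/
theorem IsCurvatureFunction.exists_deriv_height_nonneg (hf : IsCurvatureFunction K f)
    {r : Matrix (Fin n) (Fin n) ℝ} {p : E n} {z σ τ : ℝ} (hz : 0 < z) (hσ : 0 < σ)
    (hK : eigs (curvMatrix r p z) ∈ K) (hτ : τ ≤ 0) (hF : f (eigs (curvMatrix r p z)) ≤ σ)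
    (hw : slopeW p ≤ 1 / σ) :
    ∃ Gu : ℝ, 0 ≤ Gu ∧ HasDerivAt (fun ζ : ℝ => opG f r p ζ τ) Gu z := by
  have hwp := slopeW_pos p
  have hS := isHermitian_conj_of_isHermitian_curvMatrix hz.ne' (hf.isHermitian_of_eigs_mem hK)
  set μ := eigs (gammaUp p * r * gammaUp p)
  have heq : ∀ ζ : ℝ, 0 < ζ →
      eigs (curvMatrix r p ζ) = fun i => (slopeW p)⁻¹ * (1 + ζ * μ i) := fun ζ hζ =>
    eigs_affine hS hζ (inv_pos.2 hwp)
  have hdf : DifferentiableAt ℝ f (eigs (curvMatrix r p z)) :=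
    (hf.contDiffOn.differentiableOn one_ne_zero).differentiableAt (hf.isOpen.mem_nhds hK)
  rw [heq z hz] at hdf
  have hd1 : DifferentiableAt ℝ (fun ζ : ℝ => f fun i => (slopeW p)⁻¹ * (1 + ζ * μ i)) z :=
    hdf.comp (f := fun ζ : ℝ => fun i => (slopeW p)⁻¹ * (1 + ζ * μ i)) z (by fun_prop)
  have hd2 : DifferentiableAt ℝ (fun ζ : ℝ => τ / (ζ * slopeW p)) z := by
    have : z * slopeW p ≠ 0 := by positivity
    fun_prop (disch := assumption)
  have hev : (fun ζ : ℝ => opG f r p ζ τ) =ᶠ[𝓝 z]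
      fun ζ : ℝ => τ / (ζ * slopeW p) - f fun i => (slopeW p)⁻¹ * (1 + ζ * μ i) := by
    filter_upwards [lt_mem_nhds hz] with ζ hζ
    rw [opG, heq ζ hζ]
  have hd := ((hd2.sub hd1).congr_of_eventuallyEq hev).hasDerivAt
  refine ⟨_, ?_, hd⟩
  refine hasDerivAt_nonneg_of_eventually_le_right hd ?_
  have hmem : ∀ᶠ ζ in 𝓝[>] z, eigs (curvMatrix r p ζ) ∈ K := by
    have hc : ContinuousAt (fun ζ : ℝ => fun i => (slopeW p)⁻¹ * (1 + ζ * μ i)) z := by fun_prop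
    rw [heq z hz] at hK
    filter_upwards [nhdsWithin_le_nhds (hc (hf.isOpen.mem_nhds hK)),
      self_mem_nhdsWithin] with ζ hζ (hζ' : z < ζ)
    rw [heq ζ (hz.trans hζ')]
    exact hζ
  filter_upwards [hmem, self_mem_nhdsWithin] with ζ hζ (hζz : z < ζ)
  have hζ0 : 0 < ζ := hz.trans hζz
  have hh := hf.apply_eigs_height hz hζz.le hS hζ
  simp only [opG]
  set F := f (eigs (curvMatrix r p z))
  set F' := f (eigs (curvMatrix r p ζ))
  have hFw : F * slopeW p ≤ 1 := by
    rw [le_div_iff₀ hσ] at hw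
    nlinarith
  have h1 : τ / (z * slopeW p) ≤ τ / (ζ * slopeW p) := by
    rw [div_le_div_iff₀ (by positivity) (by positivity)]
    have : τ * slopeW p * (ζ - z) ≤ 0 :=
      mul_nonpos_of_nonpos_of_nonneg (mul_nonpos_of_nonpos_of_nonneg hτ hwp.le) (by linarith)
    linarith
  -- In this form the bound for `F` at height `ζ` is visibly at most `F`, because `F w ≤ σ · (1 / σ)
  -- = 1`.
  have h2 : ζ / z * F - (ζ - z) / (slopeW p * z) = F - (ζ - z) / (slopeW p * z) * (1 - F * slopeW p) := by
    field_simp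
    ring
  have h3 : 0 ≤ (ζ - z) / (slopeW p * z) * (1 - F * slopeW p) :=
    mul_nonneg (div_nonneg (by linarith) (by positivity)) (by linarith)
  linarith

/-! ### Maximum points and parabolic comparison. -/

variable {Ω : Set (E n)}

/-- The second derivative test at a local maximum of a function with gradient `g`. -/
lemma inner_fderiv_grad_nonpos_of_isLocalMax {v : E n → ℝ} {g : E n → E n} {L : E n →L[ℝ] E n}
    {x : E n} (hv : ∀ᶠ y in 𝓝 x, HasGradientAt v (g y) y) (hg : HasFDerivAt g L x)
    (hmax : IsLocalMax v x) : g x = 0 ∧ ∀ ξ : E n, inner ℝ (L ξ) ξ ≤ 0 := by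
  have hgx : g x = 0 := by
    have h1 := hmax.hasFDerivAt_eq_zero hv.self_of_nhds.hasFDerivAt
    simpa using h1
  refine ⟨hgx, fun ξ => ?_⟩
  by_contra! hpos
  have hline : ∀ s : ℝ, HasDerivAt (fun s : ℝ => x + s • ξ) ξ s := fun s => by
    simpa using ((hasDerivAt_id s).smul_const ξ).const_add x
  have hline0 : Tendsto (fun s : ℝ => x + s • ξ) (𝓝 0) (𝓝 x) := by
    simpa using (hline 0).continuousAt.tendsto
  set ψ : ℝ → ℝ := fun s => v (x + s • ξ) with hψ
  have hd : ∀ᶠ s in 𝓝 (0 : ℝ), HasDerivAt ψ (inner ℝ (g (x + s • ξ)) ξ) s := by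
    filter_upwards [hline0.eventually hv] with s hs
    have : HasDerivAt ψ _ s := hs.hasFDerivAt.comp_hasDerivAt s (hline s)
    simpa using this
  have hde : deriv ψ =ᶠ[𝓝 0] fun s => inner ℝ (g (x + s • ξ)) ξ := by
    filter_upwards [hd] with s hs using hs.deriv
  have hdd : HasDerivAt (fun s : ℝ => inner ℝ (g (x + s • ξ)) ξ) (inner ℝ (L ξ) ξ) 0 := by
    have hg' : HasFDerivAt g L (x + (0 : ℝ) • ξ) := by simpa using hg
    have := (hg'.comp_hasDerivAt (0 : ℝ) (hline 0)).inner ℝ (hasDerivAt_const (0 : ℝ) ξ)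
    simpa using this
  have hdd' : deriv (deriv ψ) 0 = inner ℝ (L ξ) ξ := by
    rw [hde.deriv_eq, hdd.deriv]
  have hd0 : deriv ψ 0 = 0 := by
    rw [hde.self_of_nhds]; simp [hgx]
  -- A positive second derivative along the line would make `0` a local minimum of `ψ` as well as a
  -- local maximum, so `ψ` would be locally constant and its second derivative zero.
  have hmin : IsLocalMin ψ 0 := isLocalMin_of_deriv_deriv_pos (by rw [hdd']; exact hpos) hd0
    hd.self_of_nhds.continuousAt
  have hconst : ψ =ᶠ[𝓝 0] fun _ => v x := by
    have hm2 : ∀ᶠ s in 𝓝 (0 : ℝ), ψ s ≤ v x := hline0.eventually hmax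
    filter_upwards [hmin, hm2] with s h1 h2
    refine le_antisymm h2 ?_
    simpa [hψ] using h1
  have h3 : deriv ψ =ᶠ[𝓝 0] fun _ => 0 := by
    filter_upwards [hconst.eventuallyEq_nhds] with s hs
    rw [hs.deriv_eq, deriv_const]
  rw [h3.deriv_eq, deriv_const] at hdd'
  linarith

lemma quadForm_hessWithin (v : E n → ℝ) (S : Set (E n)) (x ξ : E n) :
    ξ.ofLp ⬝ᵥ hessWithin v S x *ᵥ ξ.ofLp =
      inner ℝ (fderivWithin ℝ (fun y => gradientWithin v S y) S x ξ) ξ := by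
  set L := fderivWithin ℝ (fun y => gradientWithin v S y) S x with hL
  have h1 : ∀ i, (hessWithin v S x *ᵥ ξ.ofLp) i = (L ξ) i := by
    intro i
    have hξ : ξ = ∑ j, ξ j • EuclideanSpace.single j (1 : ℝ) := by
      conv_lhs => rw [← (EuclideanSpace.basisFun (Fin n) ℝ).sum_repr ξ]
      simp
    conv_rhs => rw [hξ, map_sum]
    simp only [map_smul, WithLp.ofLp_sum, Finset.sum_apply, PiLp.smul_apply, smul_eq_mul,
      Matrix.mulVec, dotProduct, hessWithin, Matrix.of_apply]
    exact Finset.sum_congr rfl fun j _ => mul_comm _ _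
  rw [EuclideanSpace.inner_eq_star_dotProduct, star_trivial]
  congr 1
  ext i
  exact h1 i

/-- `v` is differentiable near the interior point `x` of `Ω`, and twice differentiable at `x`. -/
structure TwiceDiffAt (Ω : Set (E n)) (v : E n → ℝ) (x : E n) : Prop where
  grad : ∀ᶠ y in 𝓝 x, HasGradientAt v (gradientWithin v (closure Ω) y) y
  hess : HasFDerivAt (fun y => gradientWithin v (closure Ω) y)
    (fderivWithin ℝ (fun y => gradientWithin v (closure Ω) y) (closure Ω) x) x

lemma closure_mem_nhds_of_mem (hΩ : IsOpen Ω) {x : E n} (hx : x ∈ Ω) : closure Ω ∈ 𝓝 x :=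
  mem_of_superset (hΩ.mem_nhds hx) subset_closure

lemma TwiceDiffAt.of_differentiableOn (hΩ : IsOpen Ω) {v : E n → ℝ} {x : E n} (hx : x ∈ Ω)
    (hv : DifferentiableOn ℝ v Ω)
    (hg : DifferentiableWithinAt ℝ (fun y => gradientWithin v (closure Ω) y) (closure Ω) x) :
    TwiceDiffAt Ω v x where
  grad := by
    filter_upwards [hΩ.mem_nhds hx] with y hy
    have h1 := (hv.differentiableAt (hΩ.mem_nhds hy)).differentiableWithinAt
      (s := closure Ω) |>.hasGradientWithinAt
    rw [hasGradientAt_iff_hasFDerivAt]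
    exact (hasGradientWithinAt_iff_hasFDerivWithinAt.1 h1).hasFDerivAt
      (closure_mem_nhds_of_mem hΩ hy)
  hess := hg.hasFDerivWithinAt.hasFDerivAt (closure_mem_nhds_of_mem hΩ hx)

/-- Ordering of the Hessians at a local maximum of `v₁(y + a) - v₂(y)`. -/
lemma TwiceDiffAt.compare {v₁ v₂ : E n → ℝ} {x a : E n} (h₁ : TwiceDiffAt Ω v₁ (x + a))
    (h₂ : TwiceDiffAt Ω v₂ x) (hmax : IsLocalMax (fun y => v₁ (y + a) - v₂ y) x) :
    gradientWithin v₁ (closure Ω) (x + a) = gradientWithin v₂ (closure Ω) x ∧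
      ∀ ξ : Fin n → ℝ, ξ ⬝ᵥ hessWithin v₁ (closure Ω) (x + a) *ᵥ ξ ≤
        ξ ⬝ᵥ hessWithin v₂ (closure Ω) x *ᵥ ξ := by
  have ht : Tendsto (fun y : E n => y + a) (𝓝 x) (𝓝 (x + a)) :=
    (continuous_id.add continuous_const).tendsto x
  have hg : ∀ᶠ y in 𝓝 x, HasGradientAt (fun y => v₁ (y + a) - v₂ y)
      (gradientWithin v₁ (closure Ω) (y + a) - gradientWithin v₂ (closure Ω) y) y := by
    filter_upwards [ht.eventually h₁.grad, h₂.grad] with y hy1 hy2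
    rw [hasGradientAt_iff_hasFDerivAt] at *
    rw [map_sub]
    exact ((hasFDerivAt_comp_add_right a).2 hy1).sub hy2
  have hh : HasFDerivAt (fun y => gradientWithin v₁ (closure Ω) (y + a) -
      gradientWithin v₂ (closure Ω) y) _ x :=
    ((hasFDerivAt_comp_add_right a).2 h₁.hess).sub h₂.hess
  obtain ⟨e1, e2⟩ := inner_fderiv_grad_nonpos_of_isLocalMax hg hh hmax
  refine ⟨sub_eq_zero.1 e1, fun ξ => ?_⟩
  have h3 := e2 (WithLp.toLp 2 ξ)
  have h4 := quadForm_hessWithin v₁ (closure Ω) (x + a) (WithLp.toLp 2 ξ)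
  have h5 := quadForm_hessWithin v₂ (closure Ω) x (WithLp.toLp 2 ξ)
  simp only at h4 h5
  rw [h4, h5]
  rw [sub_apply, inner_sub_left] at h3
  linarith

/-- A parabolic comparison principle for the flow. -/
theorem comparison_principle (hf : IsCurvatureFunction K f) (hΩ : IsOpen Ω)
    (hb : Bornology.IsBounded Ω) {σ t₁ m Z W B : ℝ} (hσ : 0 < σ) (hm : 0 < m)
    {V₁ V₂ τ₁ τ₂ : E n → ℝ → ℝ}
    (hc : ContinuousOn (fun z : E n × ℝ => V₁ z.1 z.2 - V₂ z.1 z.2) (closure Ω ×ˢ Icc 0 t₁))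
    (hd₁ : ∀ x ∈ Ω, ∀ t ∈ Ioc 0 t₁, TwiceDiffAt Ω (fun y => V₁ y t) x)
    (hd₂ : ∀ x ∈ Ω, ∀ t ∈ Ioc 0 t₁, TwiceDiffAt Ω (fun y => V₂ y t) x)
    (ht₁' : ∀ x ∈ Ω, ∀ t ∈ Ioc 0 t₁, HasDerivAt (V₁ x) (τ₁ x t) t)
    (ht₂' : ∀ x ∈ Ω, ∀ t ∈ Ioc 0 t₁, HasDerivAt (V₂ x) (τ₂ x t) t)
    (hK₁ : ∀ x ∈ Ω, ∀ t ∈ Ioc 0 t₁, kappa Ω (fun y => V₁ y t) x ∈ K)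
    (hK₂ : ∀ x ∈ Ω, ∀ t ∈ Ioc 0 t₁, kappa Ω (fun y => V₂ y t) x ∈ K)
    (he₁ : ∀ x ∈ Ω, ∀ t ∈ Ioc 0 t₁, τ₁ x t =
      V₁ x t * slopeW (gradientWithin (fun y => V₁ y t) (closure Ω) x) *
        (f (kappa Ω (fun y => V₁ y t) x) - σ))
    (he₂ : ∀ x ∈ Ω, ∀ t ∈ Ioc 0 t₁,
      V₂ x t * slopeW (gradientWithin (fun y => V₂ y t) (closure Ω) x) *
        (f (kappa Ω (fun y => V₂ y t) x) - σ) ≤ τ₂ x t)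
    (hB : ∀ x ∈ Ω, ∀ t ∈ Ioc 0 t₁, τ₂ x t ≤ B) (hB0 : 0 ≤ B)
    (hV₂ : ∀ x ∈ Ω, ∀ t ∈ Ioc 0 t₁, m ≤ V₂ x t) (hV₁ : ∀ x ∈ Ω, ∀ t ∈ Ioc 0 t₁, V₁ x t ≤ Z)
    (hW : ∀ x ∈ Ω, ∀ t ∈ Ioc 0 t₁, slopeW (gradientWithin (fun y => V₂ y t) (closure Ω) x) ≤ W)
    (h0 : ∀ x ∈ closure Ω, V₁ x 0 ≤ V₂ x 0)
    (hbd : ∀ x ∈ frontier Ω, ∀ t ∈ Icc 0 t₁, V₁ x t ≤ V₂ x t) :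
    ∀ x ∈ closure Ω, ∀ t ∈ Icc 0 t₁, V₁ x t ≤ V₂ x t := by
  intro x₀ hx₀ t₀ ht₀
  by_contra! hcon
  -- At a maximum with `z₁ > z₂`, `speed_comparison` bounds `τ₁ - τ₂` by `z₁ - z₂` times the first
  -- two summands: one from `((z₁ / z₂)² - 1) τ₂`, the other from the factor `w σ - 1`. The final
  -- `1` makes the weight win strictly.
  set lam : ℝ := (2 * Z) / m ^ 2 * B + Z / m * (W * σ) + 1 with hlam
  have hcomp : IsCompact (closure Ω ×ˢ Icc 0 t₁) := hb.isCompact_closure.prod isCompact_Icc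
  have hcψ : ContinuousOn (fun z : E n × ℝ => (V₁ z.1 z.2 - V₂ z.1 z.2) * Real.exp (-lam * z.2))
      (closure Ω ×ˢ Icc 0 t₁) := hc.mul (by fun_prop)
  obtain ⟨⟨x, t⟩, ⟨hx, ht⟩, hmax⟩ := hcomp.exists_isMaxOn ⟨(x₀, t₀), hx₀, ht₀⟩ hcψ
  simp only at hx ht
  have hpos : 0 < V₁ x t - V₂ x t := by
    have h1 := hmax (show (x₀, t₀) ∈ closure Ω ×ˢ Icc 0 t₁ from ⟨hx₀, ht₀⟩)
    simp only [mem_ofPred_eq] at h1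
    have h2 : 0 < (V₁ x₀ t₀ - V₂ x₀ t₀) * Real.exp (-lam * t₀) :=
      mul_pos (sub_pos.2 hcon) (Real.exp_pos _)
    exact pos_of_mul_pos_left (h2.trans_le h1) (Real.exp_pos _).le
  have ht0 : 0 < t := by
    rcases ht.1.eq_or_lt with h | h
    · rw [← h] at hpos; linarith [h0 x hx]
    · exact h
  have hxΩ : x ∈ Ω := by
    by_contra hxn
    have : x ∈ frontier Ω := by
      rw [frontier, hΩ.interior_eq]; exact ⟨hx, hxn⟩
    linarith [hbd x this t ht]
  have htm : t ∈ Ioc 0 t₁ := ⟨ht0, ht.2⟩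
  have hlm : IsLocalMax (fun y => V₁ (y + 0) t - V₂ y t) x := by
    filter_upwards [closure_mem_nhds_of_mem hΩ hxΩ] with y hy
    have h1 := hmax (show (y, t) ∈ closure Ω ×ˢ Icc 0 t₁ from ⟨hy, ht⟩)
    simp only [mem_ofPred_eq] at h1
    simpa using le_of_mul_le_mul_right h1 (Real.exp_pos _)
  obtain ⟨hgr, hhs⟩ := TwiceDiffAt.compare (v₁ := fun y => V₁ y t) (v₂ := fun y => V₂ y t)
    (a := 0) (by simpa using hd₁ x hxΩ t htm) (hd₂ x hxΩ t htm) hlm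
  simp only [add_zero] at hgr hhs
  have htime : 0 ≤ (τ₁ x t - τ₂ x t) - lam * (V₁ x t - V₂ x t) := by
    have hd : HasDerivAt (fun s => (V₁ x s - V₂ x s) * Real.exp (-lam * s))
        ((τ₁ x t - τ₂ x t) * Real.exp (-lam * t) +
          (V₁ x t - V₂ x t) * (Real.exp (-lam * t) * (-lam * 1))) t :=
      ((ht₁' x hxΩ t htm).sub (ht₂' x hxΩ t htm)).mul
        (((hasDerivAt_id t).const_mul (-lam)).exp)
    have h1 := hasDerivAt_nonneg_of_eventually_le_left hd (by
      filter_upwards [Ioo_mem_nhdsLT ht0] with s hs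
      exact hmax (show (x, s) ∈ closure Ω ×ˢ Icc 0 t₁ from ⟨hx, hs.1.le, hs.2.le.trans ht.2⟩))
    have h2 : (τ₁ x t - τ₂ x t) * Real.exp (-lam * t) +
          (V₁ x t - V₂ x t) * (Real.exp (-lam * t) * (-lam * 1)) =
        ((τ₁ x t - τ₂ x t) - lam * (V₁ x t - V₂ x t)) * Real.exp (-lam * t) := by ring
    rw [h2] at h1
    exact nonneg_of_mul_nonneg_left h1 (Real.exp_pos _)
  have hz2 := hV₂ x hxΩ t htm
  have hz1 := hV₁ x hxΩ t htm
  have hw := hW x hxΩ t htm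
  have k1 := hK₁ x hxΩ t htm
  have e1 := he₁ x hxΩ t htm
  -- The gradients agree at the maximum, so both curvature matrices have the same slope argument.
  simp only [kappa, hgr] at k1 e1
  have hkey := hf.speed_comparison (hm.trans_le hz2) (by linarith : V₂ x t ≤ V₁ x t) hhs k1
    (hK₂ x hxΩ t htm) e1 (he₂ x hxΩ t htm)
  have hτ := hB x hxΩ t htm
  have hwp := slopeW_pos (gradientWithin (fun y => V₂ y t) (closure Ω) x)
  set w := slopeW (gradientWithin (fun y => V₂ y t) (closure Ω) x)
  set z₁ := V₁ x t
  set z₂ := V₂ x t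
  have hz20 : 0 < z₂ := hm.trans_le hz2
  have hz10 : 0 < z₁ := by linarith
  have hZ : 0 < Z := by linarith
  have hratio : z₁ / z₂ ≤ Z / m := by gcongr
  have hA : ((z₁ / z₂) ^ 2 - 1) * τ₂ x t ≤ (z₁ - z₂) * ((2 * Z) / m ^ 2 * B) := by
    have h1 : (z₁ / z₂) ^ 2 - 1 = (z₁ - z₂) * ((z₁ + z₂) / z₂ ^ 2) := by
      field_simp; ring
    rw [h1, mul_assoc]
    have h2 : (z₁ + z₂) / z₂ ^ 2 ≤ (2 * Z) / m ^ 2 := by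
      gcongr
      linarith
    have h3 : (z₁ + z₂) / z₂ ^ 2 * τ₂ x t ≤ (2 * Z) / m ^ 2 * B :=
      (mul_le_mul_of_nonneg_left hτ (by positivity)).trans (mul_le_mul_of_nonneg_right h2 hB0)
    exact mul_le_mul_of_nonneg_left h3 hpos.le
  have hC : z₁ / z₂ * (z₁ - z₂) * (w * σ - 1) ≤ (z₁ - z₂) * (Z / m * (W * σ)) := by
    have h1 : z₁ / z₂ * (w * σ - 1) ≤ Z / m * (W * σ) := by
      calc z₁ / z₂ * (w * σ - 1) ≤ z₁ / z₂ * (w * σ) := by gcongr; linarith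
        _ ≤ Z / m * (W * σ) := by gcongr
    calc _ = (z₁ - z₂) * (z₁ / z₂ * (w * σ - 1)) := by ring
      _ ≤ _ := mul_le_mul_of_nonneg_left h1 hpos.le
  have : lam * (z₁ - z₂) = (z₁ - z₂) * ((2 * Z) / m ^ 2 * B) +
      (z₁ - z₂) * (Z / m * (W * σ)) + (z₁ - z₂) := by rw [hlam]; ring
  linarith

/-! ### Locality and continuity of the curvature; constant graphs. -/

lemma gradientWithin_eventuallyEq {v₁ v₂ : E n → ℝ} {S : Set (E n)} {x : E n}
    (h : v₁ =ᶠ[𝓝 x] v₂) :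
    (fun y => gradientWithin v₁ S y) =ᶠ[𝓝 x] fun y => gradientWithin v₂ S y := by
  filter_upwards [h.eventuallyEq_nhds] with y hy
  simp only [gradientWithin]
  rw [(hy.filter_mono nhdsWithin_le_nhds).fderivWithin_eq hy.self_of_nhds]

lemma hessWithin_congr {v₁ v₂ : E n → ℝ} {S : Set (E n)} {x : E n} (h : v₁ =ᶠ[𝓝 x] v₂) :
    hessWithin v₁ S x = hessWithin v₂ S x := by
  have h1 := gradientWithin_eventuallyEq (S := S) h
  simp only [hessWithin]
  rw [(h1.filter_mono nhdsWithin_le_nhds).fderivWithin_eq h1.self_of_nhds]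

lemma kappa_congr {v₁ v₂ : E n → ℝ} {x : E n} (h : v₁ =ᶠ[𝓝 x] v₂) :
    kappa Ω v₁ x = kappa Ω v₂ x := by
  have hg : gradientWithin v₁ (closure Ω) x = gradientWithin v₂ (closure Ω) x :=
    (gradientWithin_eventuallyEq h).self_of_nhds
  rw [kappa, kappa, hessWithin_congr h, hg, h.self_of_nhds]

lemma gradientWithin_const (c : ℝ) (S : Set (E n)) (x : E n) :
    gradientWithin (fun _ : E n => c) S x = 0 := by
  simp [gradientWithin]

lemma hessWithin_const (c : ℝ) (S : Set (E n)) (x : E n) :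
    hessWithin (fun _ : E n => c) S x = 0 := by
  ext i j
  simp [hessWithin, gradientWithin_const]

lemma twiceDiffAt_const (c : ℝ) (x : E n) : TwiceDiffAt Ω (fun _ => c) x where
  grad := Eventually.of_forall fun y => by
    rw [gradientWithin_const]; exact hasGradientAt_const y c
  hess := by
    simp only [gradientWithin_const]
    simpa using hasFDerivAt_const (0 : E n) x

lemma mem_frontier_of_notMem (hΩ : IsOpen Ω) {x : E n} (hx : x ∈ closure Ω) (hx' : x ∉ Ω) :
    x ∈ frontier Ω := by
  rw [frontier, hΩ.interior_eq]; exact ⟨hx, hx'⟩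

lemma eigs_zero : eigs (0 : Matrix (Fin n) (Fin n) ℝ) = 0 := by
  have h : (0 : Matrix (Fin n) (Fin n) ℝ).IsHermitian := Matrix.isHermitian_zero
  rw [eigs_of_isHermitian h, h.eigenvalues_eq_zero_iff]

/-- At an interior minimum point the curvature of a graph is at least that of a horosphere. -/
lemma IsCurvatureFunction.one_le_of_isLocalMin (hf : IsCurvatureFunction K f) {v : E n → ℝ}
    {x : E n} (hv : TwiceDiffAt Ω v x) (hx : 0 < v x) (hK : kappa Ω v x ∈ K)
    (hmin : IsLocalMin v x) : 1 ≤ f (kappa Ω v x) := by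
  -- Only the gradient and the Hessian are read off from the contact, so the constant `0` can
  -- replace the horosphere; the height `v x` enters separately.
  have hmax : IsLocalMax (fun y => (fun _ : E n => (0 : ℝ)) (y + 0) - v y) x := by
    filter_upwards [hmin] with y hy
    simpa using hy
  obtain ⟨hg, hh⟩ := TwiceDiffAt.compare (twiceDiffAt_const 0 (x + 0)) hv hmax
  rw [gradientWithin_const] at hg
  simp only [hessWithin_const] at hh
  rw [kappa, ← hg] at hK ⊢
  have hS := isHermitian_conj_of_isHermitian_curvMatrix hx.ne' (hf.isHermitian_of_eigs_mem hK)
  have hw : slopeW (0 : E n) = 1 := by simp [slopeW]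
  have h0 : eigs (curvMatrix 0 (0 : E n) (v x)) = fun _ => 1 := by
    have h1 : (gammaUp (0 : E n) * 0 * gammaUp (0 : E n)).IsHermitian := by
      simp
    have := eigs_affine h1 hx (inv_pos.2 (slopeW_pos (0 : E n)))
    rw [curvMatrix, this]
    ext i
    simp [eigs_zero, hw]
  have := (hf.apply_eigs_mono hx.le hh hS (by rw [h0]; exact hf.const_mem one_pos)).2
  rwa [h0, hf.normalized] at this

lemma slopeW_le (p : E n) {P : ℝ} (h : ‖p‖ ≤ P) : slopeW p ≤ Real.sqrt (1 + P ^ 2) := by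
  rw [slopeW]; gcongr

lemma continuous_slopeW : Continuous (slopeW : E n → ℝ) := by
  unfold slopeW; fun_prop

lemma continuous_gammaUp : Continuous (gammaUp : E n → Matrix (Fin n) (Fin n) ℝ) := by
  refine continuous_matrix fun i j => ?_
  simp only [gammaUp, Matrix.of_apply]
  refine continuous_const.sub (Continuous.div (by fun_prop)
    (continuous_slopeW.mul (continuous_const.add continuous_slopeW)) fun p => ?_)
  have := slopeW_pos p
  positivity

lemma tendsto_curvMatrix {α : Type*} {l : Filter α} {r : α → Matrix (Fin n) (Fin n) ℝ}
    {p : α → E n} {z : α → ℝ} {r₀ : Matrix (Fin n) (Fin n) ℝ} {p₀ : E n} {z₀ : ℝ}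
    (hr : Tendsto r l (𝓝 r₀)) (hp : Tendsto p l (𝓝 p₀)) (hz : Tendsto z l (𝓝 z₀)) :
    Tendsto (fun a => curvMatrix (r a) (p a) (z a)) l (𝓝 (curvMatrix r₀ p₀ z₀)) := by
  have hg := (continuous_gammaUp.tendsto p₀).comp hp
  have hw := ((continuous_slopeW.tendsto p₀).comp hp).inv₀ (slopeW_pos p₀).ne'
  exact hw.smul (tendsto_const_nhds.add (hz.smul ((hg.mul hr).mul hg)))

/-! ### Monotonicity in time, the bound `F ≤ σ`, and the lateral boundary. -/

namespace IsAdmissibleSolution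

variable {σ ε T : ℝ} {u₀ : E n → ℝ} {u : E n → ℝ → ℝ}

lemma pos_of_mem_closure (hu : IsAdmissibleSolution K f σ ε Ω T u₀ u) (hΩ : IsOpen Ω) (hε : 0 < ε)
    {x : E n} (hx : x ∈ closure Ω) {t : ℝ} (ht : t ∈ Ico 0 T) : 0 < u x t := by
  by_cases h : x ∈ Ω
  · exact hu.pos x h t ht
  · rw [hu.boundary x (mem_frontier_of_notMem hΩ hx h) t ht]; exact hε

lemma twiceDiffAt (hu : IsAdmissibleSolution K f σ ε Ω T u₀ u) (hΩ : IsOpen Ω)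
    {x : E n} (hx : x ∈ Ω) {t : ℝ} (ht : t ∈ Ico 0 T) : TwiceDiffAt Ω (fun y => u y t) x :=
  .of_differentiableOn hΩ hx ((hu.isC21.differentiableOn t ht).mono subset_closure)
    (hu.isC21.differentiable_grad (x, t) ⟨⟨subset_closure hx, ht⟩, Or.inl hx⟩)

lemma hasDerivAt_time (hu : IsAdmissibleSolution K f σ ε Ω T u₀ u)
    {x : E n} (hx : x ∈ Ω) {t : ℝ} (ht : t ∈ Ioo 0 T) :
    HasDerivAt (u x) (timeDeriv T u x t) t :=
  (hu.isC21.differentiable_time (x, t)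
    ⟨⟨subset_closure hx, ht.1.le, ht.2⟩, Or.inl hx⟩).hasDerivWithinAt.hasDerivAt
    (Ico_mem_nhds ht.1 ht.2)

lemma timeDeriv_eq (hu : IsAdmissibleSolution K f σ ε Ω T u₀ u)
    {x : E n} (hx : x ∈ Ω) {t : ℝ} (ht : t ∈ Ico 0 T) :
    timeDeriv T u x t = u x t *
      slopeW (gradientWithin (fun y => u y t) (closure Ω) x) *
        (f (kappa Ω (fun y => u y t) x) - σ) := by
  have h := hu.equation x hx t ht
  have hz := hu.pos x hx t ht
  have hw := slopeW_pos (gradientWithin (fun y => u y t) (closure Ω) x)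
  rw [opG, sub_eq_iff_eq_add, div_eq_iff (by positivity)] at h
  rw [h, kappa]; ring

lemma exists_bounds (hu : IsAdmissibleSolution K f σ ε Ω T u₀ u) (hΩ : IsOpen Ω)
    (hb : Bornology.IsBounded Ω) (hε : 0 < ε) {t₁ : ℝ} (ht₁ : t₁ < T) :
    ∃ m Z P : ℝ, 0 < m ∧ ∀ x ∈ closure Ω, ∀ t ∈ Icc 0 t₁, m ≤ u x t ∧ u x t ≤ Z ∧
      ‖gradientWithin (fun y => u y t) (closure Ω) x‖ ≤ P := by
  have hcomp : IsCompact (closure Ω ×ˢ Icc 0 t₁) := hb.isCompact_closure.prod isCompact_Icc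
  have hsub : closure Ω ×ˢ Icc 0 t₁ ⊆ closedCylinder Ω T := fun z hz =>
    ⟨hz.1, hz.2.1, hz.2.2.trans_lt ht₁⟩
  have hc := hu.isC21.continuousOn.mono hsub
  have hcg := (hu.isC21.continuousOn_grad.mono hsub).norm
  rcases (closure Ω ×ˢ Icc 0 t₁).eq_empty_or_nonempty with he | hne
  · refine ⟨1, 0, 0, one_pos, fun x hx t ht => ?_⟩
    have : (x, t) ∈ closure Ω ×ˢ Icc 0 t₁ := ⟨hx, ht⟩
    rw [he] at this
    exact this.elim
  obtain ⟨a, ha, hamin⟩ := hcomp.exists_isMinOn hne hc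
  obtain ⟨b, hb, hbmax⟩ := hcomp.exists_isMaxOn hne hc
  obtain ⟨d, hd, hdmax⟩ := hcomp.exists_isMaxOn hne hcg
  have ha' := hu.pos_of_mem_closure hΩ hε (hsub ha).1 (hsub ha).2
  refine ⟨u a.1 a.2, u b.1 b.2, ‖gradientWithin (fun y => u y d.2) (closure Ω) d.1‖, ha',
    fun x hx t ht => ?_⟩
  have hxt : (x, t) ∈ closure Ω ×ˢ Icc 0 t₁ := ⟨hx, ht⟩
  exact ⟨isMinOn_iff.1 hamin (x, t) hxt, isMaxOn_iff.1 hbmax (x, t) hxt,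
    isMaxOn_iff.1 hdmax (x, t) hxt⟩

lemma curvature_initial_le (hu : IsAdmissibleSolution K f σ ε Ω T u₀ u) (hΩ : IsOpen Ω)
    (hF₀ : ∀ x ∈ Ω, f (kappa Ω (fun y => u₀ y + ε) x) ≤ σ) {x : E n} (hx : x ∈ Ω) :
    f (kappa Ω (fun y => u y 0) x) ≤ σ := by
  have : (fun y => u y 0) =ᶠ[𝓝 x] fun y => u₀ y + ε := by
    filter_upwards [hΩ.mem_nhds hx] with y hy using hu.initial y hy
  rw [kappa_congr this]
  exact hF₀ x hx

/-- The initial graph, held fixed in time, is a supersolution: its speed is zero, while `u w (F - σ)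
≤ 0` on it. -/
lemma le_initial (hu : IsAdmissibleSolution K f σ ε Ω T u₀ u) (hf : IsCurvatureFunction K f)
    (hΩ : IsOpen Ω) (hb : Bornology.IsBounded Ω) (hσ : 0 < σ) (hε : 0 < ε)
    (hF₀ : ∀ x ∈ Ω, f (kappa Ω (fun y => u₀ y + ε) x) ≤ σ) {x : E n} (hx : x ∈ closure Ω) {t : ℝ}
    (ht : t ∈ Ico 0 T) : u x t ≤ u x 0 := by
  obtain ⟨m, Z, P, hm, hbd⟩ := hu.exists_bounds hΩ hb hε ht.2
  have h0T : (0 : ℝ) ∈ Ico 0 T := ⟨le_rfl, ht.1.trans_lt ht.2⟩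
  have h0t : (0 : ℝ) ∈ Icc 0 t := ⟨le_rfl, ht.1⟩
  have hIco : ∀ {s}, s ∈ Icc 0 t → s ∈ Ico 0 T := fun h => ⟨h.1, h.2.trans_lt ht.2⟩
  refine comparison_principle (V₁ := u) (V₂ := fun y _ => u y 0) (τ₁ := timeDeriv T u)
    (τ₂ := fun _ _ => 0) (t₁ := t) (m := m) (Z := Z) (W := Real.sqrt (1 + P ^ 2)) (B := 0)
    hf hΩ hb hσ hm ?_
    (fun y hy s hs => hu.twiceDiffAt hΩ hy (hIco (Ioc_subset_Icc_self hs)))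
    (fun y hy s hs => hu.twiceDiffAt hΩ hy h0T)
    (fun y hy s hs => hu.hasDerivAt_time hy ⟨hs.1, hs.2.trans_lt ht.2⟩)
    (fun y hy s hs => hasDerivAt_const s _)
    (fun y hy s hs => hu.admissible y hy s (hIco (Ioc_subset_Icc_self hs)))
    (fun y hy s hs => hu.admissible y hy 0 h0T)
    (fun y hy s hs => hu.timeDeriv_eq hy (hIco (Ioc_subset_Icc_self hs)))
    (fun y hy s hs => ?_) (fun y hy s hs => le_rfl) le_rfl
    (fun y hy s hs => (hbd y (subset_closure hy) 0 h0t).1)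
    (fun y hy s hs => (hbd y (subset_closure hy) s (Ioc_subset_Icc_self hs)).2.1)
    (fun y hy s hs => slopeW_le _ (hbd y (subset_closure hy) 0 h0t).2.2)
    (fun y hy => le_rfl)
    (fun y hy s hs => by rw [hu.boundary y hy s (hIco hs), hu.boundary y hy 0 h0T])
    x hx t ⟨ht.1, le_rfl⟩
  · refine ContinuousOn.sub
      (hu.isC21.continuousOn.mono fun z hz => ⟨hz.1, hIco hz.2⟩) ?_
    exact hu.isC21.continuousOn.comp (f := fun z : E n × ℝ => (z.1, (0 : ℝ))) (by fun_prop)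
      fun z hz => ⟨hz.1, h0T⟩
  · have h1 := hu.curvature_initial_le hΩ hF₀ hy
    have h2 := hu.pos y hy 0 h0T
    have h3 := slopeW_pos (gradientWithin (fun y => u y 0) (closure Ω) y)
    exact mul_nonpos_of_nonneg_of_nonpos (by positivity) (by linarith)

/-- The solution is compared with its translate in time by `h`. Both solve the flow with the same
boundary values, and `le_initial` orders them at the start. -/
lemma antitoneOn (hu : IsAdmissibleSolution K f σ ε Ω T u₀ u) (hf : IsCurvatureFunction K f)
    (hΩ : IsOpen Ω) (hb : Bornology.IsBounded Ω) (hσ : 0 < σ) (hε : 0 < ε)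
    (hF₀ : ∀ x ∈ Ω, f (kappa Ω (fun y => u₀ y + ε) x) ≤ σ) {x : E n} (hx : x ∈ closure Ω) :
    AntitoneOn (u x) (Ico 0 T) := by
  intro s₀ hs₀ t ht hst
  set h := t - s₀ with hh
  have hh0 : 0 ≤ h := sub_nonneg.2 hst
  obtain ⟨m, Z, P, hm, hbd⟩ := hu.exists_bounds hΩ hb hε ht.2
  -- The comparison needs an upper bound for the speed of `u`. Its sign is not yet known, and
  -- continuity gives no bound near the corner `∂Ω × {0}`.
  obtain ⟨C, hC⟩ := hu.isC21.bounded_timeDeriv t ht.2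
  have hI1 : ∀ {s}, s ∈ Icc 0 s₀ → s ∈ Icc 0 t := fun hs => ⟨hs.1, hs.2.trans hst⟩
  have hI2 : ∀ {s}, s ∈ Icc 0 s₀ → s + h ∈ Icc 0 t := fun hs =>
    ⟨by linarith [hs.1], by linarith [hs.2]⟩
  have hIco : ∀ {s}, s ∈ Icc 0 t → s ∈ Ico 0 T := fun h => ⟨h.1, h.2.trans_lt ht.2⟩
  have hJ : ∀ {s}, s ∈ Ioc 0 s₀ → s ∈ Icc 0 s₀ := fun hs => Ioc_subset_Icc_self hs
  have key := comparison_principle (V₁ := fun y s => u y (s + h)) (V₂ := u)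
    (τ₁ := fun y s => timeDeriv T u y (s + h))
    (τ₂ := timeDeriv T u) (t₁ := s₀) (m := m) (Z := Z) (W := Real.sqrt (1 + P ^ 2))
    (B := max C 0) hf hΩ hb hσ hm
    (ContinuousOn.sub (hu.isC21.continuousOn.comp (f := fun z : E n × ℝ => (z.1, z.2 + h))
        (by fun_prop) fun z hz => ⟨hz.1, hIco (hI2 hz.2)⟩)
      (hu.isC21.continuousOn.mono fun z hz => ⟨hz.1, hIco (hI1 hz.2)⟩))
    (fun y hy s hs => hu.twiceDiffAt hΩ hy (hIco (hI2 (hJ hs))))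
    (fun y hy s hs => hu.twiceDiffAt hΩ hy (hIco (hI1 (hJ hs))))
    (fun y hy s hs => (hu.hasDerivAt_time hy ⟨by linarith [hs.1],
      (hIco (hI2 (hJ hs))).2⟩).comp_add_const s h)
    (fun y hy s hs => hu.hasDerivAt_time hy ⟨hs.1, (hIco (hI1 (hJ hs))).2⟩)
    (fun y hy s hs => hu.admissible y hy _ (hIco (hI2 (hJ hs))))
    (fun y hy s hs => hu.admissible y hy _ (hIco (hI1 (hJ hs))))
    (fun y hy s hs => hu.timeDeriv_eq hy (hIco (hI2 (hJ hs))))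
    (fun y hy s hs => (hu.timeDeriv_eq hy (hIco (hI1 (hJ hs)))).ge)
    (fun y hy s hs => ((le_abs_self _).trans (hC y hy s (hI1 (hJ hs)))).trans (le_max_left _ _))
    (le_max_right _ _)
    (fun y hy s hs => (hbd y (subset_closure hy) s (hI1 (hJ hs))).1)
    (fun y hy s hs => (hbd y (subset_closure hy) _ (hI2 (hJ hs))).2.1)
    (fun y hy s hs => slopeW_le _ (hbd y (subset_closure hy) s (hI1 (hJ hs))).2.2)
    (fun y hy => by
      have : (0 : ℝ) + h ∈ Ico 0 T := hIco (hI2 ⟨le_rfl, hs₀.1⟩)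
      exact hu.le_initial hf hΩ hb hσ hε hF₀ hy this)
    (fun y hy s hs => by
      rw [hu.boundary y hy s (hIco (hI1 hs)), hu.boundary y hy _ (hIco (hI2 hs))])
    x hx s₀ ⟨hs₀.1, le_rfl⟩
  simpa [hh] using key

lemma timeDeriv_nonpos (hu : IsAdmissibleSolution K f σ ε Ω T u₀ u) (hf : IsCurvatureFunction K f)
    (hΩ : IsOpen Ω) (hb : Bornology.IsBounded Ω) (hσ : 0 < σ) (hε : 0 < ε)
    (hF₀ : ∀ x ∈ Ω, f (kappa Ω (fun y => u₀ y + ε) x) ≤ σ) {x : E n} (hx : x ∈ closure Ω) {t : ℝ} :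
    timeDeriv T u x t ≤ 0 :=
  (hu.antitoneOn hf hΩ hb hσ hε hF₀ hx).derivWithin_nonpos

/-- By the equation, `F - σ` has the sign of `u_t`. -/
lemma curvature_le (hu : IsAdmissibleSolution K f σ ε Ω T u₀ u) (hf : IsCurvatureFunction K f)
    (hΩ : IsOpen Ω) (hb : Bornology.IsBounded Ω) (hσ : 0 < σ) (hε : 0 < ε)
    (hF₀ : ∀ x ∈ Ω, f (kappa Ω (fun y => u₀ y + ε) x) ≤ σ) {x : E n} (hx : x ∈ Ω) {t : ℝ}
    (ht : t ∈ Ico 0 T) : f (kappa Ω (fun y => u y t) x) ≤ σ := by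
  have h1 := hu.timeDeriv_nonpos hf hΩ hb hσ hε hF₀ (subset_closure hx) (t := t)
  rw [hu.timeDeriv_eq hx ht] at h1
  have h2 := slopeW_pos (gradientWithin (fun y => u y t) (closure Ω) x)
  have h3 := hu.pos x hx t ht
  have := nonpos_of_mul_nonpos_right h1 (by positivity)
  linarith

/-- At an interior minimum the curvature would be at least `1 > σ`, so the minimum over the closure
is attained on `∂Ω`. -/
lemma boundary_value_le (hu : IsAdmissibleSolution K f σ ε Ω T u₀ u)
    (hf : IsCurvatureFunction K f)
    (hΩ : IsOpen Ω) (hb : Bornology.IsBounded Ω) (hσ : 0 < σ) (hσ' : σ < 1) (hε : 0 < ε)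
    (hF₀ : ∀ x ∈ Ω, f (kappa Ω (fun y => u₀ y + ε) x) ≤ σ) {x : E n} (hx : x ∈ closure Ω) {t : ℝ}
    (ht : t ∈ Ico 0 T) : ε ≤ u x t := by
  have hc : ContinuousOn (fun y => u y t) (closure Ω) :=
    (hu.isC21.differentiableOn t ht).continuousOn
  obtain ⟨y, hy, hmin⟩ := hb.isCompact_closure.exists_isMinOn ⟨x, hx⟩ hc
  by_cases hyΩ : y ∈ Ω
  · have h1 := hf.one_le_of_isLocalMin (hu.twiceDiffAt hΩ hyΩ ht) (hu.pos y hyΩ t ht)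
      (hu.admissible y hyΩ t ht) (hmin.isLocalMin (closure_mem_nhds_of_mem hΩ hyΩ))
    have h2 := hu.curvature_le hf hΩ hb hσ hε hF₀ hyΩ ht
    linarith
  · rw [← hu.boundary y (mem_frontier_of_notMem hΩ hy hyΩ) t ht]
    exact hmin hx

lemma timeDeriv_eq_zero_of_mem_frontier (hu : IsAdmissibleSolution K f σ ε Ω T u₀ u)
    {x : E n} (hx : x ∈ frontier Ω) {t : ℝ} (ht : t ∈ Ico 0 T) : timeDeriv T u x t = 0 := by
  rw [timeDeriv, derivWithin_congr (fun s hs => hu.boundary x hx s hs) (hu.boundary x hx t ht)]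
  simp

/-- Admissibility and the equation extend to the lateral boundary. -/
lemma kappa_mem_of_mem_frontier (hu : IsAdmissibleSolution K f σ ε Ω T u₀ u)
    (hf : IsCurvatureFunction K f) (hΩ : IsOpen Ω) (hσ : 0 < σ) (hε : 0 < ε)
    {x : E n} (hx : x ∈ frontier Ω) {t : ℝ} (ht : t ∈ Ioo 0 T) :
    kappa Ω (fun y => u y t) x ∈ K ∧ f (kappa Ω (fun y => u y t) x) = σ := by
  have ht' : t ∈ Ico 0 T := ⟨ht.1.le, ht.2⟩
  have hxc : x ∈ closure Ω := frontier_subset_closure hx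
  have hmem : ∀ y ∈ closure Ω, (y, t) ∈ closedCylinderOffCorner Ω T := fun y hy =>
    ⟨⟨hy, ht'⟩, Or.inr ht.1⟩
  have : (𝓝[Ω] x).NeBot := mem_closure_iff_nhdsWithin_neBot.1 hxc
  have hpath : Tendsto (fun y : E n => (y, t)) (𝓝[Ω] x) (𝓝[closedCylinderOffCorner Ω T] (x, t)) := by
    refine tendsto_nhdsWithin_iff.2 ⟨?_, ?_⟩
    · exact ((by fun_prop : Continuous fun y : E n => (y, t)).tendsto x).mono_left
        nhdsWithin_le_nhds
    · filter_upwards [self_mem_nhdsWithin] with y hy using hmem y (subset_closure hy)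
  have hpath' := hpath.mono_right (nhdsWithin_mono (x, t)
    (fun z (hz : z ∈ closedCylinderOffCorner Ω T) => hz.1))
  have tu := (hu.isC21.continuousOn (x, t) ⟨hxc, ht'⟩).tendsto.comp hpath'
  have tg := (hu.isC21.continuousOn_grad (x, t) ⟨hxc, ht'⟩).tendsto.comp hpath'
  have th := (hu.isC21.continuousOn_hess (x, t) (hmem x hxc)).tendsto.comp hpath
  have tt := (hu.isC21.continuousOn_timeDeriv (x, t) (hmem x hxc)).tendsto.comp hpath
  simp only [Function.comp_def] at tu tg th tt
  have tA := tendsto_curvMatrix th tg tu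
  have hA : ∀ᶠ y in 𝓝[Ω] x, (curvMatrix (hessWithin (fun y' => u y' t) (closure Ω) y)
      (gradientWithin (fun y' => u y' t) (closure Ω) y) (u y t)).IsHermitian := by
    filter_upwards [self_mem_nhdsWithin] with y hy
    exact hf.isHermitian_of_eigs_mem (hu.admissible y hy t ht')
  have te := tendsto_eigs hA (isHermitian_of_tendsto hA tA) tA
  change Tendsto (fun y => kappa Ω (fun y' => u y' t) y) (𝓝[Ω] x)
    (𝓝 (kappa Ω (fun y' => u y' t) x)) at te
  have hK : ∀ᶠ y in 𝓝[Ω] x, kappa Ω (fun y' => u y' t) y ∈ K := by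
    filter_upwards [self_mem_nhdsWithin] with y hy using hu.admissible y hy t ht'
  have hcl : kappa Ω (fun y' => u y' t) x ∈ closure K := mem_closure_of_tendsto te hK
  have tf : Tendsto (fun y => f (kappa Ω (fun y' => u y' t) y)) (𝓝[Ω] x)
      (𝓝 (f (kappa Ω (fun y' => u y' t) x))) :=
    (hf.continuousOn _ hcl).tendsto.comp (tendsto_nhdsWithin_iff.2 ⟨te, by
      filter_upwards [hK] with y hy using subset_closure hy⟩)
  have tw := (continuous_slopeW.tendsto _).comp tg
  have hz : u x t = ε := hu.boundary x hx t ht'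
  have hτ := hu.timeDeriv_eq_zero_of_mem_frontier hx ht'
  have tf' := (tt.div (tu.mul tw) (mul_pos (hu.pos_of_mem_closure hΩ hε hxc ht')
    (slopeW_pos _)).ne').add_const σ
  rw [hτ, zero_div, zero_add] at tf'
  -- The equation `F = u_t / (u w) + σ` passes to the limit from the interior, and `u_t = 0` at the
  -- boundary point.
  have heq : f (kappa Ω (fun y' => u y' t) x) = σ := by
    refine tendsto_nhds_unique tf (tf'.congr' ?_)
    filter_upwards [self_mem_nhdsWithin] with y hy
    have h1 := hu.pos y hy t ht'
    have h2 := slopeW_pos (gradientWithin (fun y' => u y' t) (closure Ω) y)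
    simp only [Pi.div_apply, Function.comp_apply, hu.timeDeriv_eq hy ht']
    field_simp
    ring
  refine ⟨?_, heq⟩
  -- A limit of admissible curvatures can leave `K` only through `∂K`, where `f = 0`; but `f = σ >
  -- 0` here.
  by_contra hn
  have := hf.zero_on_boundary _ (show _ ∈ frontier K by
    rw [frontier, hf.isOpen.interior_eq]; exact ⟨hcl, hn⟩)
  linarith

end IsAdmissibleSolution

/-! ### Geometry of the boundary: tangent directions and mean curvature. -/

lemma exists_mem_frontier_of_segment (hΩ : IsOpen Ω) {a b : E n} (ha : a ∈ Ω) (hb : b ∉ Ω) :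
    ∃ z ∈ segment ℝ a b, z ∈ frontier Ω := by
  by_contra! hcon
  have hsub : segment ℝ a b ⊆ Ω ∪ (closure Ω)ᶜ := by
    intro z hz
    by_cases hzΩ : z ∈ Ω
    · exact Or.inl hzΩ
    · exact Or.inr fun hzc => hcon z hz (mem_frontier_of_notMem hΩ hzc hzΩ)
  have hdis : Disjoint Ω (closure Ω)ᶜ :=
    disjoint_left.2 fun z hz hz' => hz' (subset_closure hz)
  rcases (convex_segment a b).isPreconnected.subset_or_subset hΩ isClosed_closure.isOpen_compl
    hdis hsub with h | h
  · exact hb (h (right_mem_segment ℝ a b))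
  · exact h (left_mem_segment ℝ a b) (subset_closure ha)

lemma eventually_pos_of_hasDerivAt {g : ℝ → ℝ} {d : ℝ} (h : HasDerivAt g d 0) (h0 : g 0 = 0)
    (hd : 0 < d) : ∀ᶠ s in 𝓝[>] (0 : ℝ), 0 < g s := by
  have h1 : Tendsto (slope g 0) (𝓝[>] 0) (𝓝 d) := (hasDerivAt_iff_tendsto_slope.1 h).mono_left
    (nhdsWithin_mono 0 (fun y (hy : 0 < y) => hy.ne'))
  filter_upwards [h1.eventually (lt_mem_nhds hd), self_mem_nhdsWithin] with s hs (hs0 : 0 < s)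
  rw [slope_def_field, h0, sub_zero, sub_zero] at hs
  exact (div_pos_iff_of_pos_right hs0).1 hs

lemma hasDerivAt_line {v : E n → ℝ} {q x : E n} (h : HasGradientAt v q x) (ξ : E n) :
    HasDerivAt (fun s : ℝ => v (x + s • ξ)) (inner ℝ q ξ) 0 := by
  have hline : HasDerivAt (fun s : ℝ => x + s • ξ) ξ 0 := by
    simpa using ((hasDerivAt_id (0 : ℝ)).smul_const ξ).const_add x
  have h' : HasFDerivAt v (InnerProductSpace.toDual ℝ (E n) q) (x + (0 : ℝ) • ξ) := by
    simpa using h.hasFDerivAt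
  have : HasDerivAt (fun s : ℝ => v (x + s • ξ)) _ 0 := h'.comp_hasDerivAt (0 : ℝ) hline
  simpa using this

lemma tendsto_line (x ξ : E n) : Tendsto (fun s : ℝ => x + s • ξ) (𝓝[>] 0) (𝓝 x) := by
  have h : Continuous (fun s : ℝ => x + s • ξ) := by fun_prop
  have := (h.tendsto 0).mono_left (nhdsWithin_le_nhds (s := Ioi 0))
  simpa using this

namespace IsLocalDefiningFunction

variable {ρ : E n → ℝ} {x : E n}

lemma contDiffAt (hρ : IsLocalDefiningFunction Ω x ρ) : ContDiffAt ℝ ∞ ρ x := by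
  obtain ⟨U, hU, hxU, hc, -, -⟩ := hρ
  exact hc.contDiffAt (hU.mem_nhds hxU)

lemma hasGradientAt (hρ : IsLocalDefiningFunction Ω x ρ) :
    HasGradientAt ρ (gradient ρ x) x :=
  (hρ.contDiffAt.differentiableAt (by simp)).hasGradientAt

lemma differentiableAt_gradient (hρ : IsLocalDefiningFunction Ω x ρ) :
    DifferentiableAt ℝ (gradient ρ) x := by
  have h1 : ContDiffAt ℝ 1 (fderiv ℝ ρ) x := 
    (hρ.contDiffAt.of_le (WithTop.coe_le_coe.2 le_top : ((2 : ℕ∞) : WithTop ℕ∞) ≤ ∞)).fderiv_right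
      (by norm_num)
  exact ((InnerProductSpace.toDual ℝ (E n)).symm.toContinuousLinearEquiv.differentiableAt).comp x
    (h1.differentiableAt one_ne_zero)

lemma eventually_mem_iff (hρ : IsLocalDefiningFunction Ω x ρ) : ∀ᶠ y in 𝓝 x, y ∈ Ω ↔ ρ y < 0 := by
  obtain ⟨U, hU, hxU, -, h, -⟩ := hρ
  filter_upwards [hU.mem_nhds hxU] with y hy using h y hy

lemma gradient_ne_zero (hρ : IsLocalDefiningFunction Ω x ρ) : gradient ρ x ≠ 0 := by
  obtain ⟨U, -, -, -, -, h⟩ := hρ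
  exact h

lemma eventually (hρ : IsLocalDefiningFunction Ω x ρ) :
    ∀ᶠ y in 𝓝 x, IsLocalDefiningFunction Ω y ρ := by
  have h1 := hρ.differentiableAt_gradient.continuousAt.eventually_ne hρ.gradient_ne_zero
  obtain ⟨U, hU, hxU, hc, h, -⟩ := hρ
  filter_upwards [hU.mem_nhds hxU, h1] with y hy hy'
  exact ⟨U, hU, hy, hc, h, hy'⟩

lemma apply_eq_zero (hρ : IsLocalDefiningFunction Ω x ρ) (hΩ : IsOpen Ω) (hx : x ∈ frontier Ω) :
    ρ x = 0 := by
  have hxn : x ∉ Ω := by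
    rw [frontier, hΩ.interior_eq] at hx; exact hx.2
  have h1 : 0 ≤ ρ x := not_lt.1 fun h => hxn (hρ.eventually_mem_iff.self_of_nhds.2 h)
  refine le_antisymm (not_lt.1 fun h => ?_) h1
  have h2 := hρ.contDiffAt.continuousAt.eventually (lt_mem_nhds h)
  have h3 := mem_closure_iff_frequently.1 (frontier_subset_closure hx)
  obtain ⟨y, hy, hy1, hy2⟩ := (h3.and_eventually (h2.and hρ.eventually_mem_iff)).exists
  linarith [hy2.1 hy]

lemma eventually_line_mem (hρ : IsLocalDefiningFunction Ω x ρ) (hΩ : IsOpen Ω)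
    (hx : x ∈ frontier Ω) {ξ : E n} (hξ : inner ℝ (gradient ρ x) ξ < 0) :
    ∀ᶠ s in 𝓝[>] (0 : ℝ), x + s • ξ ∈ Ω := by
  have hd := (hasDerivAt_line hρ.hasGradientAt ξ).neg
  have h1 := eventually_pos_of_hasDerivAt hd (by simp [hρ.apply_eq_zero hΩ hx]) (by linarith)
  filter_upwards [h1, (tendsto_line x ξ).eventually hρ.eventually_mem_iff] with s hs hs'
  exact hs'.2 (by simpa using hs)

lemma eventually_line_notMem (hρ : IsLocalDefiningFunction Ω x ρ) (hΩ : IsOpen Ω)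
    (hx : x ∈ frontier Ω) {ξ : E n} (hξ : 0 < inner ℝ (gradient ρ x) ξ) :
    ∀ᶠ s in 𝓝[>] (0 : ℝ), x + s • ξ ∉ Ω := by
  have hd := hasDerivAt_line hρ.hasGradientAt ξ
  have h1 := eventually_pos_of_hasDerivAt hd (by simp [hρ.apply_eq_zero hΩ hx]) hξ
  filter_upwards [h1, (tendsto_line x ξ).eventually hρ.eventually_mem_iff] with s hs hs'
  exact fun h => by linarith [hs'.1 h]

/-- Vectors orthogonal to the gradient of a defining function are tangent to the boundary. -/
lemma mem_tangentConeAt (hρ : IsLocalDefiningFunction Ω x ρ) (hΩ : IsOpen Ω)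
    (hx : x ∈ frontier Ω) {ζ : E n} (hζ : inner ℝ (gradient ρ x) ζ = 0) :
    ζ ∈ tangentConeAt ℝ (frontier Ω) x := by
  set q := gradient ρ x with hq
  have hq0 : 0 < ‖q‖ := norm_pos_iff.2 hρ.gradient_ne_zero
  -- For small `s` the points `x + s (ζ ∓ η q)` lie inside and outside `Ω`. The segment between them
  -- meets the boundary within distance `s η ‖q‖` of `x + s ζ`.
  have step : ∀ k : ℕ, ∃ s : ℝ, ∃ z ∈ frontier Ω, 0 < s ∧ s < 1 / ((k : ℝ) + 1) ∧
      ‖z - (x + s • ζ)‖ ≤ s * (1 / ((k : ℝ) + 1) * ‖q‖) := by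
    intro k
    set η : ℝ := 1 / ((k : ℝ) + 1) with hη
    have hη0 : 0 < η := by positivity
    have h1 := hρ.eventually_line_mem hΩ hx (ξ := ζ + (-η) • q) (by
      rw [inner_add_right, hζ, inner_smul_right, real_inner_self_eq_norm_sq]
      have : 0 < η * ‖q‖ ^ 2 := by positivity
      linarith)
    have h2 := hρ.eventually_line_notMem hΩ hx (ξ := ζ + η • q) (by
      rw [inner_add_right, hζ, inner_smul_right, real_inner_self_eq_norm_sq]
      have : 0 < η * ‖q‖ ^ 2 := by positivity
      linarith)
    obtain ⟨s, hs1, hs2, hs3⟩ := (h1.and (h2.and (Ioo_mem_nhdsGT hη0))).exists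
    obtain ⟨z, hz, hzf⟩ := exists_mem_frontier_of_segment hΩ hs1 hs2
    refine ⟨s, z, hzf, hs3.1, hs3.2, ?_⟩
    have hball : segment ℝ (x + s • (ζ + (-η) • q)) (x + s • (ζ + η • q)) ⊆
        Metric.closedBall (x + s • ζ) (s * (η * ‖q‖)) := by
      refine (convex_closedBall _ _).segment_subset ?_ ?_ <;>
      · rw [mem_closedBall_iff_norm, smul_add, add_sub_add_left_eq_sub, add_sub_cancel_left,
          norm_smul, norm_smul]
        simp [abs_of_pos hs3.1, abs_of_pos hη0]
    exact mem_closedBall_iff_norm.1 (hball hz)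
  choose s z hz hs0 hs1 hzs using step
  have hη : Tendsto (fun k : ℕ => 1 / ((k : ℝ) + 1)) atTop (𝓝 0) :=
    tendsto_one_div_add_atTop_nhds_zero_nat
  have hlim : Tendsto (fun k => (s k)⁻¹ • (z k - x)) atTop (𝓝 ζ) := by
    rw [tendsto_iff_norm_sub_tendsto_zero]
    refine squeeze_zero (fun _ => norm_nonneg _) (fun k => ?_) 
      (by simpa only [zero_mul] using hη.mul_const ‖q‖)
    have h1 : (s k)⁻¹ • (z k - x) - ζ = (s k)⁻¹ • (z k - (x + s k • ζ)) := by
      rw [← sub_sub, smul_sub _ (z k - x), smul_smul, inv_mul_cancel₀ (hs0 k).ne', one_smul]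
    rw [h1, norm_smul, norm_inv, Real.norm_of_nonneg (hs0 k).le, inv_mul_le_iff₀ (hs0 k)]
    exact hzs k
  have hs : Tendsto s atTop (𝓝 0) := squeeze_zero (fun k => (hs0 k).le) (fun k => (hs1 k).le) hη
  refine mem_tangentConeAt_of_seq atTop (fun k => (s k)⁻¹) (fun k => z k - x) ?_ ?_ hlim
  · have := hs.smul hlim
    rw [zero_smul] at this
    refine this.congr fun k => ?_
    rw [smul_smul, mul_inv_cancel₀ (hs0 k).ne', one_smul]
  · exact Eventually.of_forall fun k => by simpa using hz k

end IsLocalDefiningFunction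

/-- The derivative of a function that is constant on the boundary vanishes in tangential
directions. -/
lemma IsLocalDefiningFunction.fderiv_tangential_eq_zero {ρ : E n → ℝ} {x : E n}
    (hρ : IsLocalDefiningFunction Ω x ρ) (hΩ : IsOpen Ω) (hx : x ∈ frontier Ω) {g : E n → ℝ}
    {g' : E n →L[ℝ] ℝ} (hg : HasFDerivWithinAt g g' (closure Ω) x) {c : ℝ}
    (hc : ∀ᶠ y in 𝓝 x, y ∈ frontier Ω → g y = c) {ζ : E n}
    (hζ : inner ℝ (gradient ρ x) ζ = 0) : g' ζ = 0 := by
  have h1 : HasFDerivWithinAt g g' (frontier Ω) x := hg.mono frontier_subset_closure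
  have h2 : HasFDerivWithinAt g (0 : E n →L[ℝ] ℝ) (frontier Ω) x := by
    refine (hasFDerivWithinAt_const c x (frontier Ω)).congr_of_eventuallyEq ?_
      (hc.self_of_nhds hx)
    exact eventually_nhdsWithin_iff.2 hc
  simpa using h1.unique_on h2 (hρ.mem_tangentConeAt hΩ hx hζ)

/-- The hypothesis is tested on `N eᵢ - qᵢ q`, a multiple of the projection of `eᵢ` to the
complement of `q`, and summed over `i`. No symmetry of `B` is needed, as `B` and its transpose have
the same quadratic form. -/
lemma trace_mul_norm_sq_of_tangential (B : Matrix (Fin n) (Fin n) ℝ) (q : Fin n → ℝ)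
    (hq : q ⬝ᵥ q ≠ 0) (hB : ∀ ζ : Fin n → ℝ, q ⬝ᵥ ζ = 0 → ζ ⬝ᵥ B *ᵥ ζ = 0) :
    (q ⬝ᵥ q) * B.trace = q ⬝ᵥ B *ᵥ q := by
  set N := q ⬝ᵥ q with hN
  have h1 : ∀ i, N ^ 2 * B i i - N * (q i * (B *ᵥ q) i) - N * (q i * (Bᵀ *ᵥ q) i) +
      q i * q i * (q ⬝ᵥ B *ᵥ q) = 0 := by
    intro i
    have h := hB (N • Pi.single i 1 - q i • q) (by
      rw [dotProduct_sub, dotProduct_smul, dotProduct_smul, dotProduct_single_one, ← hN]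
      simp only [smul_eq_mul]; ring)
    rw [Matrix.mulVec_sub, Matrix.mulVec_smul, Matrix.mulVec_smul, sub_dotProduct,
      dotProduct_sub, dotProduct_sub] at h
    simp only [smul_dotProduct, dotProduct_smul, single_one_dotProduct, smul_eq_mul,
      Matrix.mulVec_single_one, Matrix.col_apply] at h
    have h3 : q ⬝ᵥ B.col i = (Bᵀ *ᵥ q) i := by
      rw [dotProduct_comm]; rfl
    rw [h3] at h
    linarith
  have h2 := Finset.sum_congr (rfl : (Finset.univ : Finset (Fin n)) = _) fun i _ => h1 i
  rw [Finset.sum_add_distrib, Finset.sum_sub_distrib, Finset.sum_sub_distrib, ← Finset.mul_sum,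
    ← Finset.mul_sum, ← Finset.mul_sum, ← Finset.sum_mul] at h2
  change N ^ 2 * B.trace - N * (q ⬝ᵥ B *ᵥ q) - N * (q ⬝ᵥ Bᵀ *ᵥ q) + N * (q ⬝ᵥ B *ᵥ q) = _ at h2
  have h4 : q ⬝ᵥ Bᵀ *ᵥ q = q ⬝ᵥ B *ᵥ q := by
    rw [Matrix.mulVec_transpose, dotProduct_comm, Matrix.dotProduct_mulVec]
  rw [h4, Finset.sum_const_zero] at h2
  have h5 : N * (N * B.trace - q ⬝ᵥ B *ᵥ q) = 0 := by linarith
  have := (mul_eq_zero.1 h5).resolve_left hq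
  linarith

lemma dotProduct_self_ofLp (p : E n) : p.ofLp ⬝ᵥ p.ofLp = ‖p‖ ^ 2 := by
  rw [← real_inner_self_eq_norm_sq, EuclideanSpace.inner_eq_star_dotProduct]; rfl

/-- The trace is cyclic, and `γ² = 1 - p ⊗ p / w²` is the inverse of the metric `1 + p ⊗ p` of the
graph. -/
lemma trace_gammaUp_conj (H : Matrix (Fin n) (Fin n) ℝ) (p : E n) :
    (gammaUp p * H * gammaUp p).trace = H.trace - (p.ofLp ⬝ᵥ H *ᵥ p.ofLp) / slopeW p ^ 2 := by
  have hw := slopeW_pos p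
  set a : ℝ := (slopeW p * (1 + slopeW p))⁻¹ with ha
  have hγ : gammaUp p = 1 - a • Matrix.vecMulVec p.ofLp p.ofLp := by
    ext i j
    simp only [gammaUp, Matrix.of_apply, Matrix.sub_apply, Matrix.one_apply, Matrix.smul_apply,
      Matrix.vecMulVec_apply, smul_eq_mul, ha]
    rw [div_eq_inv_mul]
  have hsq : gammaUp p * gammaUp p =
      1 - (slopeW p ^ 2)⁻¹ • Matrix.vecMulVec p.ofLp p.ofLp := by
    rw [hγ, sub_mul, mul_sub, mul_sub, one_mul, mul_one, Matrix.one_mul, smul_mul_smul_comm,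
      Matrix.vecMulVec_mul_vecMulVec, dotProduct_self_ofLp, Matrix.vecMulVec_smul, smul_smul,
      sub_sub, ← add_sub_assoc, ← add_smul, ← sub_smul]
    congr 2
    have := slopeW_sq p
    have h2 : ‖p‖ ^ 2 = slopeW p ^ 2 - 1 := by linarith
    rw [h2, ha]
    field_simp
    ring
  rw [Matrix.trace_mul_comm, ← Matrix.mul_assoc, hsq, sub_mul, Matrix.one_mul, Matrix.trace_sub,
    Matrix.smul_mul, Matrix.trace_smul, Matrix.vecMulVec_mul, Matrix.trace_vecMulVec, smul_eq_mul,
    dotProduct_comm, ← Matrix.dotProduct_mulVec, div_eq_inv_mul]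

lemma dotProduct_ofLp (p q : E n) : p.ofLp ⬝ᵥ q.ofLp = inner ℝ p q := by
  rw [EuclideanSpace.inner_eq_star_dotProduct, star_trivial, dotProduct_comm]

lemma eq_smul_of_orthogonal {p q : E n} (hq : q ≠ 0)
    (h : ∀ ζ : E n, inner ℝ q ζ = 0 → inner ℝ p ζ = 0) :
    p = (inner ℝ q p / ‖q‖ ^ 2) • q := by
  have hq' : ‖q‖ ^ 2 ≠ 0 := by simpa using hq
  set k := inner ℝ q p / ‖q‖ ^ 2 with hk
  have h1 : inner ℝ q (p - k • q) = 0 := by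
    rw [inner_sub_right, inner_smul_right, real_inner_self_eq_norm_sq, hk]
    field_simp
    ring
  have h2 := h _ h1
  have h3 : inner ℝ (p - k • q) (p - k • q) = 0 := by
    rw [inner_sub_left, inner_smul_left, h1, h2]; simp
  exact sub_eq_zero.1 (inner_self_eq_zero.1 h3)

lemma levelSet_trace_nonneg {ρ : E n → ℝ} {x : E n} (hq : gradient ρ x ≠ 0)
    (hH : 0 ≤ levelSetMeanCurvature ρ x) :
    0 ≤ ‖gradient ρ x‖ ^ 2 * (hessWithin ρ univ x).trace -
      (gradient ρ x).ofLp ⬝ᵥ hessWithin ρ univ x *ᵥ (gradient ρ x).ofLp := by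
  set q := gradient ρ x with hqd
  set R := hessWithin ρ univ x with hR
  have hq0 : 0 < ‖q‖ := norm_pos_iff.2 hq
  have hsum : ∑ i, ∑ j, R i j * q i * q j = q.ofLp ⬝ᵥ R *ᵥ q.ofLp := by
    simp only [dotProduct, Matrix.mulVec, Finset.mul_sum]
    exact Finset.sum_congr rfl fun i _ => Finset.sum_congr rfl fun j _ => by ring
  rcases Nat.lt_or_ge 1 n with hn | hn
  · have hn' : (0 : ℝ) < (n : ℝ) - 1 := by
      have : (1 : ℝ) < n := by exact_mod_cast hn
      linarith
    simp only [levelSetMeanCurvature, ← hqd, ← hR, hsum] at hH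
    have h1 := mul_nonneg hH hn'.le
    rw [div_mul_cancel₀ _ hn'.ne'] at h1
    have h2 := mul_nonneg h1 (pow_pos hq0 3).le
    rwa [div_mul_cancel₀ _ (pow_pos hq0 3).ne'] at h2
  -- For `n = 1` the mean curvature is a quotient by zero and says nothing, but then no nonzero
  -- vector is tangential and the expression vanishes.
  · have h1 := trace_mul_norm_sq_of_tangential R q.ofLp
      (by rw [dotProduct_self_ofLp]; positivity) (fun ζ hζ => ?_)
    · rw [dotProduct_self_ofLp] at h1
      rw [h1, sub_self]
    · have : Subsingleton (Fin n) := Fin.subsingleton_iff_le_one.2 hn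
      have hζ0 : ζ = 0 := by
        ext i
        have hqi : q i ≠ 0 := fun h => hq (by
          ext j; rw [Subsingleton.elim j i]; simpa using h)
        have h2 : q i * ζ i = 0 := by
          rw [dotProduct, Fintype.sum_eq_single i
            (fun j hj => absurd (Subsingleton.elim j i) hj)] at hζ
          exact hζ
        exact (mul_eq_zero.1 h2).resolve_left hqi
      simp [hζ0]

/-- On a mean convex boundary component where `|Dv|` is maximal, `v` being minimal and constant
there, the trace of `γ D²v γ` is nonpositive. -/
theorem trace_conj_hessWithin_nonpos {ρ v : E n → ℝ} {x : E n} {ε : ℝ}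
    (hρ : IsLocalDefiningFunction Ω x ρ) (hΩ : IsOpen Ω) (hx : x ∈ frontier Ω)
    (hH : 0 ≤ levelSetMeanCurvature ρ x) (hv : DifferentiableOn ℝ v (closure Ω))
    (hg : DifferentiableWithinAt ℝ (fun y => gradientWithin v (closure Ω) y) (closure Ω) x)
    (hvb : ∀ y ∈ frontier Ω, v y = ε) (hvε : ∀ y ∈ closure Ω, ε ≤ v y)
    (hmax : ∀ y ∈ closure Ω,
      ‖gradientWithin v (closure Ω) y‖ ≤ ‖gradientWithin v (closure Ω) x‖)
    (hp : gradientWithin v (closure Ω) x ≠ 0) :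
    (gammaUp (gradientWithin v (closure Ω) x) * hessWithin v (closure Ω) x *
      gammaUp (gradientWithin v (closure Ω) x)).trace ≤ 0 := by
  have hxc := frontier_subset_closure hx
  set g : E n → E n := fun y => gradientWithin v (closure Ω) y with hgdef
  set L := fderivWithin ℝ g (closure Ω) x with hL
  have hgL : HasFDerivWithinAt g L (closure Ω) x := hg.hasFDerivWithinAt
  have hgx : gradientWithin v (closure Ω) x = g x := rfl
  rw [hgx] at hp ⊢
  have hvd : ∀ y ∈ closure Ω,
      HasFDerivWithinAt v (InnerProductSpace.toDual ℝ (E n) (g y)) (closure Ω) y := fun y hy =>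
    (hv y hy).hasGradientWithinAt.hasFDerivWithinAt
  have htang : ∀ y ∈ frontier Ω, IsLocalDefiningFunction Ω y ρ → ∀ ζ : E n,
      inner ℝ (gradient ρ y) ζ = 0 → inner ℝ (g y) ζ = 0 := by
    intro y hy hρy ζ hζ
    simpa using hρy.fderiv_tangential_eq_zero hΩ hy (hvd y (frontier_subset_closure hy))
      (Eventually.of_forall hvb) hζ
  set q := gradient ρ x with hq
  have hq0 : 0 < ‖q‖ := norm_pos_iff.2 hρ.gradient_ne_zero
  set k := inner ℝ q (g x) / ‖q‖ ^ 2 with hk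
  -- As `v` is constant on the boundary, its gradient is normal.
  have hpk : g x = k • q := eq_smul_of_orthogonal hρ.gradient_ne_zero (htang x hx hρ)
  have hcone : -q ∈ posTangentConeAt (closure Ω) x := by
    refine mem_posTangentConeAt_of_frequently_mem (Eventually.frequently ?_)
    filter_upwards [hρ.eventually_line_mem hΩ hx (ξ := -q) (by
      rw [inner_neg_right, real_inner_self_eq_norm_sq]
      have : 0 < ‖q‖ ^ 2 := by positivity
      linarith)] with s hs using subset_closure hs
  have hk0 : k < 0 := by
    have hmin : IsMinOn v (closure Ω) x := fun y hy => by
      rw [mem_ofPred_eq, hvb x hx]; exact hvε y hy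
    have h1 := hmin.localize.hasFDerivWithinAt_nonneg (hvd x hxc) hcone
    rw [hpk] at h1
    have h2 : 0 ≤ -(k * ‖q‖ ^ 2) := by
      simpa [inner_smul_left] using h1
    have h3 : k ≤ 0 := by
      by_contra! h
      have : 0 < k * ‖q‖ ^ 2 := by positivity
      linarith
    refine lt_of_le_of_ne h3 fun h => hp ?_
    rw [hpk, h, zero_smul]
  -- The function `|Dv|²` cannot increase in the inward direction `-q`; since `Dv = k q` with `k <
  -- 0`, this fixes the sign of the normal second derivative.
  have hLq : inner ℝ (L q) q ≤ 0 := by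
    have hm : IsMaxOn (fun y => ‖g y‖ ^ 2) (closure Ω) x := fun y hy => by
      rw [mem_ofPred_eq]
      have := hmax y hy
      have h0 := norm_nonneg (g y)
      change ‖g y‖ ^ 2 ≤ ‖g x‖ ^ 2
      gcongr
    have h1 := hm.localize.hasFDerivWithinAt_nonpos hgL.norm_sq hcone
    rw [hpk] at h1
    have h2 : 0 ≤ k * inner ℝ q (L q) := by
      simpa [inner_smul_left] using h1
    rw [real_inner_comm] at h2
    nlinarith
  set R := fderiv ℝ (gradient ρ) x with hR
  have hgR : HasFDerivWithinAt (gradient ρ) R (closure Ω) x :=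
    hρ.differentiableAt_gradient.hasFDerivAt.hasFDerivWithinAt
  -- On the boundary `Dv` is parallel to `Dρ`, so `⟨Dv, ζ⟩⟨Dρ, q⟩ - ⟨Dv, q⟩⟨Dρ, ζ⟩` vanishes there
  -- (`ζ` and `q` fixed). Its derivative along `ζ` gives `D²v(ζ, ζ) = k D²ρ(ζ, ζ)`.
  have hbil : ∀ ζ : E n, inner ℝ q ζ = 0 →
      ‖q‖ ^ 2 * inner ℝ (L ζ) ζ = k * ‖q‖ ^ 2 * inner ℝ (R ζ) ζ := by
    intro ζ hζ
    have hd := ((hgL.inner ℝ (hasFDerivWithinAt_const ζ x (closure Ω))).mul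
      (hgR.inner ℝ (hasFDerivWithinAt_const q x (closure Ω)))).sub
      ((hgL.inner ℝ (hasFDerivWithinAt_const q x (closure Ω))).mul
      (hgR.inner ℝ (hasFDerivWithinAt_const ζ x (closure Ω))))
    have h0 := hρ.fderiv_tangential_eq_zero hΩ hx hd (c := 0) (by
      filter_upwards [hρ.eventually] with y hy hyf
      have := eq_smul_of_orthogonal hy.gradient_ne_zero (htang y hyf hy)
      simp only [Pi.sub_apply, Pi.mul_apply]
      rw [this]
      simp only [inner_smul_left]
      ring) hζ
    have hpζ := htang x hx hρ ζ hζ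
    have hpq : inner ℝ (g x) q = k * ‖q‖ ^ 2 := by
      rw [hpk, inner_smul_left, real_inner_self_eq_norm_sq]; rfl
    simp only [sub_apply, add_apply, smul_apply, smul_eq_mul,
      ContinuousLinearMap.coe_comp, Function.comp_apply, ContinuousLinearMap.prod_apply,
      zero_apply, fderivInnerCLM_apply, inner_zero_right, zero_add, ← hq, hζ, hpζ, hpq,
      real_inner_self_eq_norm_sq, zero_mul, add_zero] at h0
    linarith
  set Hv := hessWithin v (closure Ω) x with hHv
  set Hρ := hessWithin ρ univ x with hHρ
  have hQv : ∀ ζ : E n, ζ.ofLp ⬝ᵥ Hv *ᵥ ζ.ofLp = inner ℝ (L ζ) ζ :=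
    fun ζ => quadForm_hessWithin v (closure Ω) x ζ
  have hQρ : ∀ ζ : E n, ζ.ofLp ⬝ᵥ Hρ *ᵥ ζ.ofLp = inner ℝ (R ζ) ζ := fun ζ => by
    rw [quadForm_hessWithin ρ univ x ζ]
    simp only [gradientWithin_univ, fderivWithin_univ, hR]
  have htr := trace_mul_norm_sq_of_tangential (Hv - k • Hρ) q.ofLp
    (by rw [dotProduct_self_ofLp]; positivity) (fun ζ hζ => by
      have h1 := hbil (WithLp.toLp 2 ζ) (by rw [← dotProduct_ofLp]; exact hζ)
      rw [← hQv, ← hQρ] at h1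
      simp only [Matrix.sub_mulVec, Matrix.smul_mulVec, dotProduct_sub, dotProduct_smul,
        smul_eq_mul]
      have h2 : ‖q‖ ^ 2 * (ζ ⬝ᵥ Hv *ᵥ ζ - k * (ζ ⬝ᵥ Hρ *ᵥ ζ)) = 0 := by
        simp only at h1
        linarith
      exact (mul_eq_zero.1 h2).resolve_left (by positivity))
  simp only [Matrix.sub_mulVec, Matrix.smul_mulVec, dotProduct_sub, dotProduct_smul,
    smul_eq_mul, Matrix.trace_sub, Matrix.trace_smul, dotProduct_self_ofLp] at htr
  have hmc := levelSet_trace_nonneg hρ.gradient_ne_zero hH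
  rw [← hq, ← hHρ] at hmc
  -- The tangential trace of `D²v` is `k` times that of `D²ρ`, which has the sign of the mean
  -- curvature, and `k < 0`.
  have hle : ‖q‖ ^ 2 * Hv.trace ≤ q.ofLp ⬝ᵥ Hv *ᵥ q.ofLp := by
    have : k * (‖q‖ ^ 2 * Hρ.trace - q.ofLp ⬝ᵥ Hρ *ᵥ q.ofLp) ≤ 0 :=
      mul_nonpos_of_nonpos_of_nonneg hk0.le hmc
    linarith
  have hQq : q.ofLp ⬝ᵥ Hv *ᵥ q.ofLp ≤ 0 := by rw [hQv]; exact hLq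
  rw [trace_gammaUp_conj, sub_nonpos, slopeW_sq, hpk, norm_smul, mul_pow, Real.norm_eq_abs, sq_abs]
  have hQp : (k • q).ofLp ⬝ᵥ Hv *ᵥ (k • q).ofLp = k ^ 2 * (q.ofLp ⬝ᵥ Hv *ᵥ q.ofLp) := by
    simp only [WithLp.ofLp_smul, Matrix.mulVec_smul, dotProduct_smul, smul_dotProduct, smul_eq_mul]
    ring
  rw [hQp, le_div_iff₀ (by positivity)]
  -- It remains to show `(1 + k² ‖q‖²) tr Hv ≤ k² Q`: the trace is nonpositive by `hle` and `Q ≤ 0`,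
  -- and `k²` times `hle` covers the rest.
  set Q := q.ofLp ⬝ᵥ Hv *ᵥ q.ofLp
  have htr0 : Hv.trace ≤ 0 := by
    by_contra! h
    have : 0 < ‖q‖ ^ 2 * Hv.trace := by positivity
    linarith
  have := mul_le_mul_of_nonneg_left hle (sq_nonneg k)
  linarith

/-! ### The global gradient bound. -/

/-- The mean value inequality for the extension of `v` by its boundary value. -/
lemma exists_inner_gradient_ge {v : E n → ℝ} {g : E n → E n} {ε h : ℝ} {x e : E n} (hΩ : IsOpen Ω)
    (hc : ContinuousOn v (closure Ω)) (hg : ∀ y ∈ Ω, HasGradientAt v (g y) y)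
    (hvb : ∀ y ∈ frontier Ω, v y = ε) (hvε : ∀ y ∈ closure Ω, ε ≤ v y) (hh : 0 < h)
    (hx : x ∈ closure Ω) (hxe : x + h • e ∈ closure Ω) (hlt : v x < v (x + h • e)) :
    ∃ s ∈ Ioo 0 h, x + s • e ∈ Ω ∧ (v (x + h • e) - v x) / h ≤ inner ℝ (g (x + s • e)) e := by
  have hline : Continuous (fun s : ℝ => x + s • e) := by fun_prop
  have hend : x + h • e ∈ Ω := by
    by_contra hn
    rw [hvb _ (mem_frontier_of_notMem hΩ hxe hn)] at hlt
    linarith [hvε x hx]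
  -- The segment may leave `Ω`. Here `s₁` is the last parameter outside `Ω`, or `0` if there is
  -- none; at an exit point `v = ε ≤ v x`, so starting there only increases the slope.
  obtain ⟨s₁, hs₁, hin, hcl, hle⟩ : ∃ s₁ ∈ Ico 0 h, (∀ s ∈ Ioc s₁ h, x + s • e ∈ Ω) ∧
      x + s₁ • e ∈ closure Ω ∧ v (x + s₁ • e) ≤ v x := by
    set S : Set ℝ := Icc 0 h ∩ (fun s : ℝ => x + s • e) ⁻¹' Ωᶜ with hS
    rcases S.eq_empty_or_nonempty with he | hne
    · refine ⟨0, ⟨le_rfl, hh⟩, fun s hs => ?_, by simpa using hx, by simp⟩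
      by_contra hn
      have : s ∈ S := ⟨⟨hs.1.le, hs.2⟩, hn⟩
      rw [he] at this
      exact this
    · have hcomp : IsCompact S := isCompact_Icc.inter_right (hΩ.isClosed_compl.preimage hline)
      obtain ⟨s₁, hs₁, hgr⟩ := hcomp.exists_isGreatest hne
      have hs₁h : s₁ < h := lt_of_le_of_ne hs₁.1.2 fun h' => hs₁.2 (by rw [h']; exact hend)
      have hin : ∀ s ∈ Ioc s₁ h, x + s • e ∈ Ω := fun s hs => by
        by_contra hn
        exact absurd (hgr ⟨⟨hs₁.1.1.trans hs.1.le, hs.2⟩, hn⟩) (not_le.2 hs.1)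
      have hcl : x + s₁ • e ∈ closure Ω := by
        refine mem_closure_of_tendsto ((hline.tendsto s₁).mono_left
          (nhdsWithin_le_nhds (s := Ioi s₁))) ?_
        filter_upwards [Ioo_mem_nhdsGT hs₁h] with s hs using hin s ⟨hs.1, hs.2.le⟩
      refine ⟨s₁, ⟨hs₁.1.1, hs₁h⟩, hin, hcl, ?_⟩
      rw [hvb _ (mem_frontier_of_notMem hΩ hcl hs₁.2)]
      exact hvε x hx
  have hcont : ContinuousOn (fun s : ℝ => v (x + s • e)) (Icc s₁ h) := by
    refine hc.comp hline.continuousOn fun s hs => ?_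
    rcases hs.1.eq_or_lt with h' | h'
    · rw [← h']; exact hcl
    · exact subset_closure (hin s ⟨h', hs.2⟩)
  have hder : ∀ s ∈ Ioo s₁ h, HasDerivAt (fun s : ℝ => v (x + s • e))
      (inner ℝ (g (x + s • e)) e) s := fun s hs => by
    have h1 : HasDerivAt (fun s : ℝ => x + s • e) e s := by
      simpa using ((hasDerivAt_id s).smul_const e).const_add x
    have h2 : HasDerivAt (fun s : ℝ => v (x + s • e)) _ s :=
      (hg _ (hin s ⟨hs.1, hs.2.le⟩)).hasFDerivAt.comp_hasDerivAt s h1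
    simpa using h2
  obtain ⟨c, hc1, hc2⟩ := exists_hasDerivAt_eq_slope _ _ hs₁.2 hcont hder
  refine ⟨c, ⟨hs₁.1.trans_lt hc1.1, hc1.2⟩, hin c ⟨hc1.1, hc1.2.le⟩, ?_⟩
  rw [hc2]
  have h1 : 0 < h - s₁ := sub_pos.2 hs₁.2
  have h2 : h - s₁ ≤ h := by linarith [hs₁.1]
  have h3 : 0 ≤ v (x + h • e) - v (x + s₁ • e) := by linarith
  gcongr

/-- The critical slope `L` satisfies `1 + L² = 1 / σ²` and `L ≤ 1 / σ`, so `1 + (L + b)² ≤ (1 / σ +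
b)²`. The growth factor is thus linear in the excess `b`. -/
lemma slopeW_mul_sub_one_le {σ b : ℝ} (hσ : 0 < σ) (hσ' : σ < 1) (hb : 0 ≤ b) {p : E n}
    (hp : ‖p‖ ≤ Real.sqrt ((1 / σ) ^ 2 - 1) + b) : slopeW p * σ - 1 ≤ b := by
  set L := Real.sqrt ((1 / σ) ^ 2 - 1) with hL
  have h1σ : 1 < 1 / σ := by rw [lt_div_iff₀ hσ]; linarith
  have hL2 : L ^ 2 = (1 / σ) ^ 2 - 1 := Real.sq_sqrt (by nlinarith)
  have hL0 : 0 ≤ L := Real.sqrt_nonneg _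
  have hLσ : L ≤ 1 / σ := by
    rw [hL, Real.sqrt_le_left (by positivity)]
    linarith
  have hw : slopeW p ≤ 1 / σ + b := by
    rw [slopeW, Real.sqrt_le_left (by positivity)]
    have h2 : ‖p‖ ^ 2 ≤ (L + b) ^ 2 := by gcongr
    nlinarith [mul_le_mul_of_nonneg_right hLσ hb]
  have h3 := mul_le_mul_of_nonneg_right hw hσ.le
  have h4 : (1 / σ + b) * σ = 1 + b * σ := by field_simp
  nlinarith

lemma slopeW_le_iff {σ : ℝ} (hσ : 0 < σ) (hσ' : σ < 1) {p : E n} :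
    slopeW p ≤ 1 / σ ↔ ‖p‖ ≤ Real.sqrt ((1 / σ) ^ 2 - 1) := by
  have h1σ : 1 < 1 / σ := by rw [lt_div_iff₀ hσ]; linarith
  rw [slopeW, Real.sqrt_le_left (by positivity), Real.le_sqrt (norm_nonneg _)]
  · constructor <;> intro h <;> linarith
  · nlinarith

namespace IsAdmissibleSolution

variable {σ ε T : ℝ} {u₀ : E n → ℝ} {u : E n → ℝ → ℝ}

/-- The gradient bound at a boundary point where the gradient is maximal. -/
theorem slopeW_le_of_isMaxOn_frontier (hu : IsAdmissibleSolution K f σ ε Ω T u₀ u) (hn : 1 ≤ n)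
    (hf : IsCurvatureFunction K f) (hΩ : IsBoundedSmoothDomain Ω) (hH : MeanConvexBoundary Ω)
    (hσ : 0 < σ) (hσ' : σ < 1) (hε : 0 < ε)
    (hF₀ : ∀ x ∈ Ω, f (kappa Ω (fun y => u₀ y + ε) x) ≤ σ) {x : E n} (hx : x ∈ frontier Ω) {t : ℝ}
    (ht : t ∈ Ioo 0 T)
    (hmax : ∀ y ∈ closure Ω, ‖gradientWithin (fun y => u y t) (closure Ω) y‖ ≤
      ‖gradientWithin (fun y => u y t) (closure Ω) x‖) :
    slopeW (gradientWithin (fun y => u y t) (closure Ω) x) ≤ 1 / σ := by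
  have ht' : t ∈ Ico 0 T := ⟨ht.1.le, ht.2⟩
  have hxc := frontier_subset_closure hx
  have hwp := slopeW_pos (gradientWithin (fun y => u y t) (closure Ω) x)
  by_cases hp : gradientWithin (fun y => u y t) (closure Ω) x = 0
  · rw [hp, le_div_iff₀ hσ]
    simpa [slopeW] using hσ'.le
  obtain ⟨ρ, hρ⟩ := hΩ.smooth_boundary x hx
  have htr := trace_conj_hessWithin_nonpos hρ hΩ.isOpen hx (hH x hx ρ hρ)
    (hu.isC21.differentiableOn t ht')
    (hu.isC21.differentiable_grad (x, t) ⟨⟨hxc, ht'⟩, Or.inr ht.1⟩)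
    (fun y hy => hu.boundary y hy t ht')
    (fun y hy => hu.boundary_value_le hf hΩ.isOpen hΩ.isBounded hσ hσ' hε hF₀ hy ht') hmax hp
  obtain ⟨hK, hF⟩ := hu.kappa_mem_of_mem_frontier hf hΩ.isOpen hσ hε hx ht
  -- The chain is `σ = f(κ) ≤ (∑ κᵢ) / n = (1 + u tr (γ D²u γ) / n) / w ≤ 1 / w`.
  have h1 := hf.le_mean hn hK
  rw [hF, kappa, sum_eigs_eq_trace (hf.isHermitian_of_eigs_mem hK), curvMatrix, Matrix.trace_smul,
    Matrix.trace_add, Matrix.trace_one, Matrix.trace_smul, Fintype.card_fin, smul_eq_mul,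
    smul_eq_mul] at h1
  have hn' : (0 : ℝ) < n := by exact_mod_cast hn
  set w := slopeW (gradientWithin (fun y => u y t) (closure Ω) x)
  rw [le_div_iff₀ hn', inv_mul_eq_div, le_div_iff₀ hwp] at h1
  have h2 := mul_nonpos_of_nonneg_of_nonpos
    (hu.pos_of_mem_closure hΩ.isOpen hε hxc ht').le htr
  rw [le_div_iff₀ hσ]
  have h3 : (w * σ) * n ≤ 1 * n := by linarith
  exact le_of_mul_le_mul_right h3 hn'

/-- The initial gradient bound extends to the closure. -/
lemma slopeW_initial_le (hu : IsAdmissibleSolution K f σ ε Ω T u₀ u) (hΩ : IsOpen Ω) (hσ : 0 < σ)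
    (hT : 0 < T)
    (hw₀ : ∀ x ∈ Ω, σ < 1 / slopeW (gradientWithin u₀ (closure Ω) x)) {x : E n}
    (hx : x ∈ closure Ω) : slopeW (gradientWithin (fun y => u y 0) (closure Ω) x) ≤ 1 / σ := by
  have h0T : (0 : ℝ) ∈ Ico 0 T := ⟨le_rfl, hT⟩
  have : (𝓝[Ω] x).NeBot := mem_closure_iff_nhdsWithin_neBot.1 hx
  have hpath : Tendsto (fun y : E n => (y, (0 : ℝ))) (𝓝[Ω] x)
      (𝓝[closedCylinder Ω T] (x, 0)) := by
    refine tendsto_nhdsWithin_iff.2 ⟨?_, ?_⟩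
    · exact ((by fun_prop : Continuous fun y : E n => (y, (0 : ℝ))).tendsto x).mono_left
        nhdsWithin_le_nhds
    · filter_upwards [self_mem_nhdsWithin] with y hy using ⟨subset_closure hy, h0T⟩
  have tg := (hu.isC21.continuousOn_grad (x, 0) ⟨hx, h0T⟩).tendsto.comp hpath
  have tw := (continuous_slopeW.tendsto _).comp tg
  refine le_of_tendsto tw ?_
  filter_upwards [self_mem_nhdsWithin] with y hy
  have heq : gradientWithin (fun y => u y 0) (closure Ω) y = gradientWithin u₀ (closure Ω) y := by
    have h1 : (fun y => u y 0) =ᶠ[𝓝 y] fun y => u₀ y + ε := by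
      filter_upwards [hΩ.mem_nhds hy] with z hz using hu.initial z hz
    refine (gradientWithin_eventuallyEq (S := closure Ω) h1).self_of_nhds.trans ?_
    simp [gradientWithin]
  have h2 := hw₀ y hy
  have h3 := slopeW_pos (gradientWithin u₀ (closure Ω) y)
  simp only [Function.comp_apply, heq]
  rw [lt_div_iff₀ h3] at h2
  rw [le_div_iff₀ hσ]
  linarith

end IsAdmissibleSolution

namespace IsAdmissibleSolution

variable {σ ε T : ℝ} {u₀ : E n → ℝ} {u : E n → ℝ → ℝ}

/-- At an interior maximum point of a weighted spatial difference quotient, the growth rate of the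
difference quotient is controlled by `w σ - 1`. -/
lemma difference_quotient_rate_le (hu : IsAdmissibleSolution K f σ ε Ω T u₀ u)
    (hf : IsCurvatureFunction K f) (hΩ : IsOpen Ω) (hb : Bornology.IsBounded Ω) (hσ : 0 < σ)
    (hε : 0 < ε) (hF₀ : ∀ x ∈ Ω, f (kappa Ω (fun y => u₀ y + ε) x) ≤ σ)
    {h t t₁ L lam : ℝ} {e x : E n} (hh : 0 < h) (hx : x ∈ Ω) (hxe : x + h • e ∈ Ω)
    (ht : t ∈ Ioo 0 T) (ht₁ : t ≤ t₁) (hlt : u x t ≤ u (x + h • e) t)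
    (hmax : ∀ y ∈ closure Ω, y + h • e ∈ closure Ω → ∀ s ∈ Icc 0 t₁,
      ((u (y + h • e) s - u y s) / h - L) * Real.exp (-lam * s) ≤
        ((u (x + h • e) t - u x t) / h - L) * Real.exp (-lam * t)) :
    lam * ((u (x + h • e) t - u x t) / h - L) ≤
      u (x + h • e) t / u x t * ((u (x + h • e) t - u x t) / h) *
        (slopeW (gradientWithin (fun y => u y t) (closure Ω) x) * σ - 1) := by
  have ht' : t ∈ Ico 0 T := ⟨ht.1.le, ht.2⟩
  have hlm : IsLocalMax (fun y => u (y + h • e) t - u y t) x := by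
    have hshift : Tendsto (fun y : E n => y + h • e) (𝓝 x) (𝓝 (x + h • e)) :=
      (continuous_id.add continuous_const).tendsto x
    filter_upwards [closure_mem_nhds_of_mem hΩ hx,
      hshift (closure_mem_nhds_of_mem hΩ hxe)] with y hy hy'
    have h1 := le_of_mul_le_mul_right (hmax y hy hy' t ⟨ht.1.le, ht₁⟩) (Real.exp_pos _)
    exact (div_le_div_iff_of_pos_right hh).1 (by linarith)
  obtain ⟨hgr, hhs⟩ := TwiceDiffAt.compare (v₁ := fun y => u y t) (v₂ := fun y => u y t)
    (hu.twiceDiffAt hΩ hxe ht') (hu.twiceDiffAt hΩ hx ht') hlm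
  have htime : 0 ≤ (timeDeriv T u (x + h • e) t - timeDeriv T u x t) / h -
      lam * ((u (x + h • e) t - u x t) / h - L) := by
    have hd : HasDerivAt (fun s => ((u (x + h • e) s - u x s) / h - L) * Real.exp (-lam * s))
        ((timeDeriv T u (x + h • e) t - timeDeriv T u x t) / h * Real.exp (-lam * t) +
          ((u (x + h • e) t - u x t) / h - L) * (Real.exp (-lam * t) * (-lam * 1))) t :=
      ((((hu.hasDerivAt_time hxe ht).sub (hu.hasDerivAt_time hx ht)).div_const h).sub_const L).mul
        (((hasDerivAt_id t).const_mul (-lam)).exp)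
    have h1 := hasDerivAt_nonneg_of_eventually_le_left hd (by
      filter_upwards [Ioo_mem_nhdsLT ht.1] with s hs
      exact hmax x (subset_closure hx) (subset_closure hxe) s ⟨hs.1.le, hs.2.le.trans ht₁⟩)
    refine nonneg_of_mul_nonneg_left (b := Real.exp (-lam * t)) ?_ (Real.exp_pos _)
    linarith
  have hz2 := hu.pos x hx t ht'
  have k1 := hu.admissible _ hxe t ht'
  have e1 := hu.timeDeriv_eq hxe ht'
  simp only [kappa, hgr] at k1 e1
  have hkey := hf.speed_comparison hz2 hlt hhs k1 (hu.admissible x hx t ht') e1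
    (hu.timeDeriv_eq hx ht').ge
  have hτ := hu.timeDeriv_nonpos hf hΩ hb hσ hε hF₀ (subset_closure hx) (t := t)
  set z₁ := u (x + h • e) t
  set z₂ := u x t
  set w := slopeW (gradientWithin (fun y => u y t) (closure Ω) x)
  have hr : 1 ≤ z₁ / z₂ := (one_le_div hz2).2 hlt
  -- Here `u_t ≤ 0` is essential: the factor `(z₁ / z₂)² ≥ 1` can be dropped.
  have h2 : (z₁ / z₂) ^ 2 * timeDeriv T u x t ≤ timeDeriv T u x t := by
    simpa using mul_le_mul_of_nonpos_right (one_le_pow₀ hr (n := 2)) hτ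
  have h3 : (timeDeriv T u (x + h • e) t - timeDeriv T u x t) / h ≤
      z₁ / z₂ * (z₁ - z₂) * (w * σ - 1) / h := by
    gcongr
    linarith
  calc lam * ((z₁ - z₂) / h - L) ≤ z₁ / z₂ * (z₁ - z₂) * (w * σ - 1) / h := by linarith
    _ = _ := by ring

/-- The global gradient bound. -/
theorem norm_gradient_le (hu : IsAdmissibleSolution K f σ ε Ω T u₀ u) (hn : 1 ≤ n)
    (hf : IsCurvatureFunction K f) (hΩ : IsBoundedSmoothDomain Ω) (hH : MeanConvexBoundary Ω)
    (hσ : 0 < σ) (hσ' : σ < 1) (hε : 0 < ε) (hT : 0 < T)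
    (hF₀ : ∀ x ∈ Ω, f (kappa Ω (fun y => u₀ y + ε) x) ≤ σ)
    (hw₀ : ∀ x ∈ Ω, σ < 1 / slopeW (gradientWithin u₀ (closure Ω) x))
    {x₀ : E n} (hx₀ : x₀ ∈ closure Ω) {t₁ : ℝ} (ht₁ : t₁ ∈ Ico 0 T) :
    ‖gradientWithin (fun y => u y t₁) (closure Ω) x₀‖ ≤ Real.sqrt ((1 / σ) ^ 2 - 1) := by
  by_contra! hcon
  set L := Real.sqrt ((1 / σ) ^ 2 - 1) with hL
  have hL0 : 0 ≤ L := Real.sqrt_nonneg _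
  have hO := hΩ.isOpen
  obtain ⟨m, Z, P, hm, hbd⟩ := hu.exists_bounds hO hΩ.isBounded hε ht₁.2
  set g : E n → ℝ → E n := fun x t => gradientWithin (fun y => u y t) (closure Ω) x with hg
  -- The rate estimate allows growth `Z / m * P` times the full excess `δ`, while the maximal
  -- quotient is only known to reach half of it; hence the factor `2`, with `1` for strictness.
  set lam : ℝ := 2 * (Z / m * P) + 1 with hlam
  set C : Set (E n × ℝ) := closure Ω ×ˢ Icc 0 t₁ with hC
  have hcomp : IsCompact C := hΩ.isBounded.isCompact_closure.prod isCompact_Icc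
  have hsub : C ⊆ closedCylinder Ω T := fun z hz => ⟨hz.1, hz.2.1, hz.2.2.trans_lt ht₁.2⟩
  set Ψ : E n × ℝ → ℝ := fun z => (‖g z.1 z.2‖ - L) * Real.exp (-lam * z.2) with hΨ
  have hΨc : ContinuousOn Ψ C :=
    ((hu.isC21.continuousOn_grad.mono hsub).norm.sub continuousOn_const).mul (by fun_prop)
  have hz₀ : (x₀, t₁) ∈ C := ⟨hx₀, ht₁.1, le_rfl⟩
  obtain ⟨⟨xs, ts⟩, hzs, hmax⟩ := hcomp.exists_isMaxOn ⟨_, hz₀⟩ hΨc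
  set δ := Ψ (xs, ts) with hδ
  have hle : ∀ z ∈ C, Ψ z ≤ δ := fun z hz => isMaxOn_iff.1 hmax z hz
  have hδ0 : 0 < δ := by
    have h1 : Ψ (x₀, t₁) ≤ δ := hle _ hz₀
    have h2 : 0 < Ψ (x₀, t₁) := mul_pos (sub_pos.2 hcon) (Real.exp_pos _)
    exact h2.trans_le h1
  -- Every maximum point of the weighted excess is interior and at positive time, by the initial
  -- bound and the boundary estimate.
  have hclaim : ∀ z ∈ C, δ ≤ Ψ z → z.1 ∈ Ω ∧ z.2 ∈ Ioo 0 T := by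
    rintro ⟨x, t⟩ hz hΨz
    have hpos : L < ‖g x t‖ :=
      sub_pos.1 (pos_of_mul_pos_left (hδ0.trans_le hΨz) (Real.exp_pos _).le)
    have ht0 : 0 < t := by
      rcases hz.2.1.eq_or_lt with h | h
      · simp only at h
        have h2 := (slopeW_le_iff hσ hσ').1 (hu.slopeW_initial_le hO hσ hT hw₀ hz.1)
        simp only [hg, ← h] at hpos
        exact absurd h2 (not_le.2 hpos)
      · exact h
    have htT : t ∈ Ioo 0 T := ⟨ht0, (hsub hz).2.2⟩
    refine ⟨?_, htT⟩
    by_contra hn'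
    have h1 := hu.slopeW_le_of_isMaxOn_frontier hn hf hΩ hH hσ hσ' hε hF₀
      (mem_frontier_of_notMem hO hz.1 hn') htT (fun y hy => by
        have h2 : Ψ (y, t) ≤ Ψ (x, t) := (hle (y, t) ⟨hy, hz.2⟩).trans hΨz
        have h3 := le_of_mul_le_mul_right h2 (Real.exp_pos _)
        simp only at h3
        exact (sub_le_sub_iff_right L).1 h3)
    exact absurd ((slopeW_le_iff hσ hσ').1 h1) (not_le.2 hpos)
  obtain ⟨hxsΩ, htsT⟩ := hclaim _ hzs le_rfl
  simp only at hxsΩ htsT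
  have hps : L < ‖g xs ts‖ := sub_pos.1 (pos_of_mul_pos_left hδ0 (Real.exp_pos _).le)
  have hps0 : 0 < ‖g xs ts‖ := hL0.trans_lt hps
  -- The direction is frozen at one maximum point of `Ψ`, so that difference quotients along `e`
  -- there tend to `|Du|`.
  set e : E n := ‖g xs ts‖⁻¹ • g xs ts with he
  have hen : ‖e‖ = 1 := by
    rw [he, norm_smul, norm_inv, norm_norm, inv_mul_cancel₀ hps0.ne']
  have hgrad : ∀ t ∈ Ico 0 T, ∀ y ∈ Ω, HasGradientAt (fun y => u y t) (g y t) y :=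
    fun t ht y hy => (hu.twiceDiffAt hO hy ht).grad.self_of_nhds
  set Φ : ℝ → E n × ℝ → ℝ := fun h z =>
    ((u (z.1 + h • e) z.2 - u z.1 z.2) / h - L) * Real.exp (-lam * z.2) with hΦ
  have hlimΦ : Tendsto (fun h => Φ h (xs, ts)) (𝓝[>] 0) (𝓝 δ) := by
    have h1 := hasDerivAt_line (hgrad ts ⟨htsT.1.le, htsT.2⟩ xs hxsΩ) e
    have h2 : inner ℝ (g xs ts) e = ‖g xs ts‖ := by
      rw [he, inner_smul_right, real_inner_self_eq_norm_sq]
      field_simp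
    rw [h2, hasDerivAt_iff_tendsto_slope] at h1
    have h3 : Tendsto (slope (fun s : ℝ => u (xs + s • e) ts) 0) (𝓝[>] 0) (𝓝 ‖g xs ts‖) :=
      h1.mono_left (nhdsWithin_mono 0 (fun y (hy : 0 < y) => hy.ne'))
    refine ((h3.sub_const L).mul_const (Real.exp (-lam * ts))).congr fun h => ?_
    simp [hΦ, slope_def_field]
  have hmvt : ∀ h, 0 < h → ∀ z ∈ C, z.1 + h • e ∈ closure Ω → 0 < Φ h z →
      u z.1 z.2 < u (z.1 + h • e) z.2 ∧ ∃ y, (y, z.2) ∈ C ∧ ‖y - z.1‖ ≤ h ∧ Φ h z ≤ Ψ (y, z.2) ∧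
        (u (z.1 + h • e) z.2 - u z.1 z.2) / h ≤ ‖g y z.2‖ := by
    rintro h hh ⟨x, t⟩ hz hxe hpos
    have hq : L < (u (x + h • e) t - u x t) / h :=
      sub_pos.1 (pos_of_mul_pos_left hpos (Real.exp_pos _).le)
    have hlt : u x t < u (x + h • e) t := by
      have := (div_pos_iff_of_pos_right hh).1 (hL0.trans_lt hq)
      linarith
    refine ⟨hlt, ?_⟩
    have htT : t ∈ Ico 0 T := (hsub hz).2
    obtain ⟨s, hs, hsΩ, hsl⟩ := exists_inner_gradient_ge (v := fun y => u y t)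
      (g := fun y => g y t) hO (hu.isC21.differentiableOn t htT).continuousOn (hgrad t htT)
      (fun y hy => hu.boundary y hy t htT)
      (fun y hy => hu.boundary_value_le hf hO hΩ.isBounded hσ hσ' hε hF₀ hy htT) hh hz.1 hxe hlt
    have hnorm : (u (x + h • e) t - u x t) / h ≤ ‖g (x + s • e) t‖ := by
      refine hsl.trans ((real_inner_le_norm _ _).trans ?_)
      rw [hen, mul_one]
    refine ⟨x + s • e, ⟨subset_closure hsΩ, hz.2⟩, ?_, ?_, hnorm⟩
    · rw [add_sub_cancel_left, norm_smul, hen, mul_one, Real.norm_of_nonneg hs.1.le]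
      exact hs.2.le
    · exact mul_le_mul_of_nonneg_right (sub_le_sub_right hnorm L) (Real.exp_pos _).le
  -- The factor `1 - 1 / (2 (k + 1))` tends to `1`, which makes limits of the maximum points of `Φ`
  -- maximal for `Ψ`, and never falls below `1 / 2`.
  have hstep : ∀ k : ℕ, ∃ h : ℝ, 0 < h ∧ h < 1 / ((k : ℝ) + 1) ∧ ∃ z ∈ C,
      z.1 + h • e ∈ closure Ω ∧ δ * (1 - 1 / (2 * ((k : ℝ) + 1))) ≤ Φ h z ∧
      ∀ z' ∈ C, z'.1 + h • e ∈ closure Ω → Φ h z' ≤ Φ h z := by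
    intro k
    have hlt : δ * (1 - 1 / (2 * ((k : ℝ) + 1))) < δ := by
      have : 0 < 1 / (2 * ((k : ℝ) + 1)) := by positivity
      nlinarith
    have hk : (0 : ℝ) < 1 / ((k : ℝ) + 1) := by positivity
    obtain ⟨h, h1, h2, h3⟩ := ((hlimΦ.eventually (lt_mem_nhds hlt)).and
      (((tendsto_line xs e).eventually (hO.mem_nhds hxsΩ)).and (Ioo_mem_nhdsGT hk))).exists
    have hD : IsCompact (C ∩ (fun z : E n × ℝ => z.1 + h • e) ⁻¹' closure Ω) :=
      hcomp.inter_right (isClosed_closure.preimage (by fun_prop))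
    have hΦc : ContinuousOn (Φ h) (C ∩ (fun z : E n × ℝ => z.1 + h • e) ⁻¹' closure Ω) := by
      refine ContinuousOn.mul (ContinuousOn.sub (ContinuousOn.div_const (ContinuousOn.sub ?_ ?_) h)
        continuousOn_const) (by fun_prop)
      · exact hu.isC21.continuousOn.comp (f := fun z : E n × ℝ => (z.1 + h • e, z.2))
          (by fun_prop) fun z hz => ⟨hz.2, (hsub hz.1).2⟩
      · exact hu.isC21.continuousOn.mono fun z hz => hsub hz.1
    have hmemD : (xs, ts) ∈ C ∩ (fun z : E n × ℝ => z.1 + h • e) ⁻¹' closure Ω :=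
      ⟨hzs, subset_closure h2⟩
    obtain ⟨z, hz, hzmax⟩ := hD.exists_isMaxOn ⟨_, hmemD⟩ hΦc
    exact ⟨h, h3.1, h3.2, z, hz.1, hz.2, h1.le.trans (isMaxOn_iff.1 hzmax _ hmemD),
      fun z' hz' hz'e => isMaxOn_iff.1 hzmax z' ⟨hz', hz'e⟩⟩
  choose h hh0 hh1 z hzC hze hzδ hzmax using hstep
  have hhalf : ∀ k : ℕ, δ / 2 ≤ δ * (1 - 1 / (2 * ((k : ℝ) + 1))) := by
    intro k
    have h1 : 1 / (2 * ((k : ℝ) + 1)) ≤ 1 / 2 := by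
      have hk : (0 : ℝ) ≤ k := Nat.cast_nonneg k
      exact one_div_le_one_div_of_le two_pos (by linarith)
    nlinarith
  have hzpos : ∀ k, 0 < Φ (h k) (z k) := fun k => by
    linarith [hzδ k, hhalf k]
  have hη : Tendsto (fun k : ℕ => 1 / ((k : ℝ) + 1)) atTop (𝓝 0) :=
    tendsto_one_div_add_atTop_nhds_zero_nat
  have hh : Tendsto h atTop (𝓝 0) := squeeze_zero (fun k => (hh0 k).le) (fun k => (hh1 k).le) hη
  choose hlt y hyC hyz hΦy hyn using fun k => hmvt (h k) (hh0 k) (z k) (hzC k) (hze k) (hzpos k)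
  obtain ⟨zb, hzb, φ, hφ, hlim⟩ := hcomp.tendsto_subseq hzC
  have hx1 : Tendsto (fun k => (z (φ k)).1) atTop (𝓝 zb.1) :=
    (continuous_fst.tendsto zb).comp hlim
  have hx2 : Tendsto (fun k => (z (φ k)).2) atTop (𝓝 zb.2) :=
    (continuous_snd.tendsto zb).comp hlim
  have hhφ : Tendsto (fun k => h (φ k)) atTop (𝓝 0) := hh.comp hφ.tendsto_atTop
  have hy1 : Tendsto (fun k => y (φ k)) atTop (𝓝 zb.1) := by
    have h1 : Tendsto (fun k => y (φ k) - (z (φ k)).1) atTop (𝓝 0) :=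
      squeeze_zero_norm (fun k => hyz (φ k)) hhφ
    simpa using h1.add hx1
  -- The mean value points `y` have the same limit as the `z`, and `Ψ` there dominates `Φ`. Thus
  -- `hclaim` makes the limit interior, and eventually both end points of the quotient lie in `Ω`.
  have hΨb : δ ≤ Ψ zb := by
    have h1 : Tendsto (fun k => ((y (φ k), (z (φ k)).2) : E n × ℝ)) atTop (𝓝[C] zb) :=
      tendsto_nhdsWithin_iff.2 ⟨hy1.prodMk_nhds hx2, Eventually.of_forall fun k => hyC (φ k)⟩
    have h2 := (hΨc zb hzb).tendsto.comp h1
    have h3 : Tendsto (fun k : ℕ => δ * (1 - 1 / (2 * ((k : ℝ) + 1)))) atTop (𝓝 δ) := by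
      have h4 : Tendsto (fun k : ℕ => δ * (1 - 1 / ((k : ℝ) + 1) * (1 / 2))) atTop
          (𝓝 (δ * (1 - 0 * (1 / 2)))) := ((hη.mul_const _).const_sub 1).const_mul δ
      rw [zero_mul, sub_zero, mul_one] at h4
      refine h4.congr fun k => ?_
      rw [mul_comm (2 : ℝ), ← div_div, div_eq_mul_one_div (1 / ((k : ℝ) + 1))]
    refine le_of_tendsto_of_tendsto' (h3.comp hφ.tendsto_atTop) h2 fun k => ?_
    exact (hzδ (φ k)).trans (hΦy (φ k))
  obtain ⟨hbΩ, hbT⟩ := hclaim zb hzb hΨb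
  have hxe : Tendsto (fun k => (z (φ k)).1 + h (φ k) • e) atTop (𝓝 zb.1) := by
    simpa using hx1.add (hhφ.smul_const e)
  obtain ⟨k, hk1, hk2, hk3⟩ := ((hx1.eventually (hO.mem_nhds hbΩ)).and
    ((hxe.eventually (hO.mem_nhds hbΩ)).and (hx2.eventually (lt_mem_nhds hbT.1)))).exists
  set j := φ k
  have htj : (z j).2 ∈ Ioo 0 T := ⟨hk3, (hsub (hzC j)).2.2⟩
  have hrate := hu.difference_quotient_rate_le hf hO hΩ.isBounded hσ hε hF₀ (hh0 j) hk1 hk2 htj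
    (hzC j).2.2 (hlt j).le (L := L) (lam := lam)
    (fun y hy hye s hs => hzmax j (y, s) ⟨hy, hs⟩ hye)
  have hEpos := Real.exp_pos (lam * (z j).2)
  have hEinv : Real.exp (-lam * (z j).2) * Real.exp (lam * (z j).2) = 1 := by
    rw [← Real.exp_add, neg_mul, neg_add_cancel, Real.exp_zero]
  have hΨj : ‖g (z j).1 (z j).2‖ ≤ L + δ * Real.exp (lam * (z j).2) := by
    have h1 := mul_le_mul_of_nonneg_right (hle (z j) (hzC j)) hEpos.le
    simp only [hΨ] at h1
    rw [mul_assoc, hEinv, mul_one] at h1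
    linarith
  have hwσ := slopeW_mul_sub_one_le hσ hσ' (by positivity) hΨj
  have hΦj : δ / 2 * Real.exp (lam * (z j).2) ≤
      (u ((z j).1 + h j • e) (z j).2 - u (z j).1 (z j).2) / h j - L := by
    have h1 := mul_le_mul_of_nonneg_right ((hhalf j).trans (hzδ j)) hEpos.le
    simp only [hΦ] at h1
    rwa [mul_assoc (_ - L), hEinv, mul_one] at h1
  have hb1 := hbd (z j).1 (hzC j).1 (z j).2 (hzC j).2
  have hb2 := hbd ((z j).1 + h j • e) (hze j) (z j).2 (hzC j).2
  have hb3 := (hyn j).trans (hbd (y j) (hyC j).1 (z j).2 (hzC j).2).2.2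
  have hltj := hlt j
  set Q := (u ((z j).1 + h j • e) (z j).2 - u (z j).1 (z j).2) / h j with hQ
  have hQ0 : 0 < Q := div_pos (sub_pos.2 hltj) (hh0 j)
  have hlam0 : 0 < lam := by
    have : 0 ≤ Z / m * P := mul_nonneg (div_nonneg (by linarith) hm.le) (by linarith)
    rw [hlam]; linarith
  have hfin : lam * (δ / 2 * Real.exp (lam * (z j).2)) ≤
      Z / m * P * (δ * Real.exp (lam * (z j).2)) := by
    refine (mul_le_mul_of_nonneg_left hΦj hlam0.le).trans (hrate.trans ?_)
    have hZ : 0 < Z := by linarith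
    have hr : u ((z j).1 + h j • e) (z j).2 / u (z j).1 (z j).2 * Q ≤ Z / m * P :=
      mul_le_mul (div_le_div₀ hZ.le hb2.2.1 hm hb1.1) hb3 hQ0.le (by positivity)
    have hr0 : 0 ≤ u ((z j).1 + h j • e) (z j).2 / u (z j).1 (z j).2 * Q :=
      mul_nonneg (div_nonneg (by linarith) (by linarith)) hQ0.le
    exact (mul_le_mul_of_nonneg_left hwσ hr0).trans
      (mul_le_mul_of_nonneg_right hr (by positivity))
  have hpos : 0 < δ * Real.exp (lam * (z j).2) := by positivity
  have : lam * (δ / 2 * Real.exp (lam * (z j).2)) = (Z / m * P + 1 / 2) *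
      (δ * Real.exp (lam * (z j).2)) := by rw [hlam]; ring
  linarith

end IsAdmissibleSolution

/-! ### The maximum principle for the linearized operator. -/

lemma TwiceDiffAt.isHermitian_hessWithin {v : E n → ℝ} {x : E n} (hv : TwiceDiffAt Ω v x) :
    (hessWithin v (closure Ω) x).IsHermitian := by
  have h1 : ∀ᶠ y in 𝓝 x, HasFDerivAt v
      (InnerProductSpace.toDual ℝ (E n) (gradientWithin v (closure Ω) y)) y := by
    filter_upwards [hv.grad] with y hy using hy.hasFDerivAt
  have h2 := ((InnerProductSpace.toDual ℝ (E n)).toContinuousLinearEquiv.toContinuousLinearMap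
    |>.hasFDerivAt).comp x hv.hess
  have h3 := second_derivative_symmetric_of_eventually h1 h2
  rw [isHermitian_iff_transpose]
  ext i j
  have h4 := h3 (EuclideanSpace.single i 1) (EuclideanSpace.single j 1)
  simpa [hessWithin, EuclideanSpace.inner_single_right] using h4

lemma TwiceDiffAt.of_contDiffOn (hΩ : IsOpen Ω) {v : E n → ℝ} (hv : ContDiffOn ℝ 2 v Ω) {x : E n}
    (hx : x ∈ Ω) : TwiceDiffAt Ω v x := by
  refine .of_differentiableOn hΩ hx (hv.differentiableOn two_ne_zero) ?_
  have h1 : ContDiffAt ℝ 1 (fderiv ℝ v) x :=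
    (hv.contDiffAt (hΩ.mem_nhds hx)).fderiv_right (by norm_num)
  have h2 : DifferentiableAt ℝ (gradient v) x :=
    ((InnerProductSpace.toDual ℝ (E n)).symm.toContinuousLinearEquiv.differentiableAt).comp x
      (h1.differentiableAt one_ne_zero)
  refine (h2.congr_of_eventuallyEq ?_).differentiableWithinAt
  filter_upwards [hΩ.mem_nhds hx] with y hy
  rw [gradientWithin, gradient, fderivWithin_of_mem_nhds (closure_mem_nhds_of_mem hΩ hy)]

/-- Positivity of the linearized operator at a positive interior maximum which increases in
time. -/
lemma IsCurvatureFunction.linearized_pos (hf : IsCurvatureFunction K f)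
    {r R : Matrix (Fin n) (Fin n) ℝ} {p : E n} {z τ φ ν Gu ℓ : ℝ} (hz : 0 < z) (hφ : 0 < φ)
    (hν : 0 < ν) (hK : eigs (curvMatrix r p z) ∈ K) (hR : R.IsHermitian)
    (hR0 : ∀ ξ : Fin n → ℝ, ξ ⬝ᵥ R *ᵥ ξ ≤ 0) (hGu : 0 ≤ Gu)
    (hG : HasDerivAt (fun ζ : ℝ => opG f r p ζ τ) Gu z)
    (hℓ : HasDerivAt (fun s : ℝ => opG f (r + s • R) p (z + s * φ) (τ + s * ν)) ℓ 0) : 0 < ℓ := by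
  have hwp := slopeW_pos p
  have hS := isHermitian_conj_of_isHermitian_curvMatrix hz.ne' (hf.isHermitian_of_eigs_mem hK)
  have hlin : HasDerivAt (fun s : ℝ => z + s * φ) φ 0 := by
    simpa using ((hasDerivAt_id (0 : ℝ)).mul_const φ).const_add z
  have hk1 : HasDerivAt (fun s : ℝ => opG f r p (z + s * φ) τ) (Gu * φ) 0 := by
    have hG' : HasDerivAt (fun ζ : ℝ => opG f r p ζ τ) Gu (z + 0 * φ) := by simpa using hG
    exact hG'.comp (0 : ℝ) hlin
  have hk2 : HasDerivAt (fun s : ℝ => s * ν / ((z + s * φ) * slopeW p))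
      (ν / (z * slopeW p)) 0 := by
    have h1 := ((hasDerivAt_id (0 : ℝ)).mul_const ν).div (hlin.mul_const (slopeW p))
      (by simpa using ⟨hz.ne', hwp.ne'⟩)
    refine HasDerivAt.congr_deriv h1 ?_
    simp only [id, zero_mul, add_zero, one_mul, sub_zero]
    field_simp
  -- After removing the variation in height (with `τ` frozen) and the time term, only `F(r) - F(r +
  -- s R)` at the common height `z + s φ` is left. It is nonnegative for `s > 0`, so no chain rule
  -- for `F` in the matrix is needed.
  have hd := hℓ.sub (hk1.add hk2)
  have hd0 := hasDerivAt_nonneg_of_eventually_le_right hd (by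
    have hsh : ∀ s : ℝ, (gammaUp p * (r + s • R) * gammaUp p).IsHermitian := fun s => by
      have h1 := isHermitian_conj hR p
      rw [isHermitian_iff_transpose] at *
      rw [Matrix.mul_add, Matrix.add_mul, Matrix.transpose_add, hS, Matrix.mul_smul,
        Matrix.smul_mul, Matrix.transpose_smul, h1]
    have htend : Tendsto (fun s : ℝ => curvMatrix (r + s • R) p (z + s * φ)) (𝓝 0)
        (𝓝 (curvMatrix r p z)) := by
      refine tendsto_curvMatrix ?_ tendsto_const_nhds ?_
      · have : Continuous fun s : ℝ => r + s • R := by fun_prop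
        simpa using this.tendsto 0
      · have : Continuous fun s : ℝ => z + s * φ := by fun_prop
        simpa using this.tendsto 0
    have hte := tendsto_eigs (Eventually.of_forall fun s => isHermitian_affine (hsh s) _ _)
      (hf.isHermitian_of_eigs_mem hK) htend
    filter_upwards [nhdsWithin_le_nhds (hte (hf.isOpen.mem_nhds hK)), self_mem_nhdsWithin]
      with s hs (hs0 : 0 < s)
    have hzs : 0 < z + s * φ := by positivity
    have hmono := (hf.apply_eigs_mono hzs.le (r₁ := r + s • R) (r₂ := r) (fun ξ => by
      rw [Matrix.add_mulVec, Matrix.smul_mulVec, dotProduct_add, dotProduct_smul, smul_eq_mul]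
      have := mul_nonpos_of_nonneg_of_nonpos hs0.le (hR0 ξ)
      linarith) hS hs).2
    simp only [Pi.sub_apply, Pi.add_apply, opG, zero_smul, zero_mul, add_zero, zero_div, sub_self,
      add_div]
    linarith)
  have h1 : 0 ≤ Gu * φ := by positivity
  have h2 : 0 < ν / (z * slopeW p) := by positivity
  linarith

namespace IsAdmissibleSolution

variable {σ ε T : ℝ} {u₀ : E n → ℝ} {u : E n → ℝ → ℝ}

/-- At a maximum of `v - δ t` where `v > M ≥ 0`, the gradient vanishes, the Hessian is nonpositive
and `v_t ≥ δ > 0`; as `v > 0`, the zeroth-order term `G_u v` has the right sign and `linearized_pos`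
contradicts `𝔏 v ≤ 0`. -/
theorem linearizedMaximumPrinciple (hu : IsAdmissibleSolution K f σ ε Ω T u₀ u)
    (hf : IsCurvatureFunction K f) (hΩ : IsOpen Ω) (hb : Bornology.IsBounded Ω)
    (hGu : ∀ x ∈ Ω, ∀ t ∈ Ico 0 T, ∃ Gu : ℝ, 0 ≤ Gu ∧
      HasDerivAt (fun ζ : ℝ => opG f (hessWithin (fun y => u y t) (closure Ω) x)
        (gradientWithin (fun y => u y t) (closure Ω) x) ζ (timeDeriv T u x t)) Gu (u x t)) :
    LinearizedMaximumPrinciple f Ω T u := by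
  intro v hvc hv2 hvt hvL M hM hv0 hvb x₀ hx₀ t₀ ht₀
  by_contra! hcon
  have ht₀0 : 0 < t₀ := by
    rcases ht₀.1.eq_or_lt with h | h
    · rw [← h] at hcon; exact absurd (hv0 x₀ hx₀) (not_le.2 hcon)
    · exact h
  -- The penalty `δ t₀` spends half of the excess of `v` over `M`, so `v > M` persists at the
  -- maximum point.
  set δ : ℝ := (v x₀ t₀ - M) / (2 * t₀) with hδ
  have hδ0 : 0 < δ := div_pos (sub_pos.2 hcon) (by positivity)
  have hδt : δ * t₀ = (v x₀ t₀ - M) / 2 := by rw [hδ]; field_simp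
  have hcomp : IsCompact (closure Ω ×ˢ Icc 0 t₀) := hb.isCompact_closure.prod isCompact_Icc
  have hc : ContinuousOn (fun z : E n × ℝ => v z.1 z.2 - δ * z.2) (closure Ω ×ˢ Icc 0 t₀) :=
    (hvc.mono fun z hz => ⟨hz.1, hz.2.1, hz.2.2.trans_lt ht₀.2⟩).sub (by fun_prop)
  have hmem₀ : (x₀, t₀) ∈ closure Ω ×ˢ Icc 0 t₀ := ⟨hx₀, ht₀0.le, le_rfl⟩
  obtain ⟨⟨x, t⟩, ⟨hx, ht⟩, hmax⟩ := hcomp.exists_isMaxOn ⟨_, hmem₀⟩ hc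
  simp only at hx ht
  have hmax' : ∀ y ∈ closure Ω, ∀ s ∈ Icc 0 t₀, v y s - δ * s ≤ v x t - δ * t :=
    fun y hy s hs => isMaxOn_iff.1 hmax (y, s) ⟨hy, hs⟩
  have hvM : M < v x t := by
    have h1 := hmax' x₀ hx₀ t₀ ⟨ht₀0.le, le_rfl⟩
    have h2 : 0 ≤ δ * t := mul_nonneg hδ0.le ht.1
    linarith
  have ht0 : 0 < t := by
    rcases ht.1.eq_or_lt with h | h
    · rw [← h] at hvM; exact absurd (hv0 x hx) (not_le.2 hvM)
    · exact h
  have htT : t ∈ Ioo 0 T := ⟨ht0, ht.2.trans_lt ht₀.2⟩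
  have htT' : t ∈ Ico 0 T := ⟨ht0.le, htT.2⟩
  have hxΩ : x ∈ Ω := by
    by_contra hn
    exact absurd (hvb x (mem_frontier_of_notMem hΩ hx hn) t htT') (not_le.2 hvM)
  have htd := TwiceDiffAt.of_contDiffOn hΩ (hv2 t htT) hxΩ
  obtain ⟨hgr, hhs⟩ := TwiceDiffAt.compare (v₁ := fun y => v y t) (v₂ := fun _ => (0 : ℝ))
    (x := x) (a := 0) (by simpa using htd) (twiceDiffAt_const 0 x) (by
      filter_upwards [closure_mem_nhds_of_mem hΩ hxΩ] with y hy
      have := hmax' y hy t ht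
      simpa using this)
  rw [add_zero, gradientWithin_const] at hgr
  simp only [add_zero, hessWithin_const, Matrix.zero_mulVec, dotProduct_zero] at hhs
  have hν : δ ≤ timeDeriv T v x t := by
    have hd := (hvt x hxΩ t htT).hasDerivAt
    have heq : timeDeriv T v x t = deriv (fun s => v x s) t :=
      derivWithin_of_mem_nhds (Ico_mem_nhds htT.1 htT.2)
    rw [heq]
    have h1 := hasDerivAt_nonneg_of_eventually_le_left
      (hd.sub ((hasDerivAt_id t).const_mul δ)) (by
        filter_upwards [Ioo_mem_nhdsLT ht0] with s hs
        exact hmax' x hx s ⟨hs.1.le, hs.2.le.trans ht.2⟩)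
    linarith
  obtain ⟨ℓ, hℓ0, hℓ⟩ := hvL x hxΩ t htT
  obtain ⟨Gu, hGu0, hG⟩ := hGu x hxΩ t htT'
  rw [LinearizedOpEq, hgr] at hℓ
  simp only [smul_zero, add_zero] at hℓ
  have := hf.linearized_pos (hu.pos x hxΩ t htT') (hM.trans_lt hvM) (hδ0.trans_le hν)
    (hu.admissible x hxΩ t htT') htd.isHermitian_hessWithin hhs hGu0 hG hℓ
  linarith

end IsAdmissibleSolution

end HypFlow

theorem proposition4p3 (n : ℕ) (hn : 1 ≤ n)
    (K : Set (Fin n → ℝ)) (f : (Fin n → ℝ) → ℝ) (hf : HypFlow.IsCurvatureFunction K f)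
    (Ω : Set (HypFlow.E n)) (hΩ : HypFlow.IsBoundedSmoothDomain Ω)
    (hH : HypFlow.MeanConvexBoundary Ω)
    (σ : ℝ) (hσ : 0 < σ) (hσ' : σ < 1) (ε : ℝ) (hε : 0 < ε) (T : ℝ) (hT : 0 < T)
    (u₀ : HypFlow.E n → ℝ) (u : HypFlow.E n → ℝ → ℝ)
    (hu : HypFlow.IsAdmissibleSolution K f σ ε Ω T u₀ u)
    (hF₀ : ∀ x ∈ Ω, f (HypFlow.kappa Ω (fun y => u₀ y + ε) x) ≤ σ)
    (hw₀ : ∀ x ∈ Ω, σ < 1 / HypFlow.slopeW (gradientWithin u₀ (closure Ω) x)) :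
    -- `κ[u] ∈ K`, `G_u ≥ 0` and `F ≤ σ` wherever the second derivatives are defined
    (∀ z ∈ HypFlow.closedCylinderOffCorner Ω T,
      HypFlow.kappa Ω (fun y => u y z.2) z.1 ∈ K ∧
      (∃ Gu : ℝ, 0 ≤ Gu ∧
        HasDerivAt (fun ζ : ℝ => HypFlow.opG f
          (HypFlow.hessWithin (fun y => u y z.2) (closure Ω) z.1)
          (gradientWithin (fun y => u y z.2) (closure Ω) z.1) ζ
          (HypFlow.timeDeriv T u z.1 z.2)) Gu (u z.1 z.2)) ∧
      f (HypFlow.kappa Ω (fun y => u y z.2) z.1) ≤ σ) ∧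
    -- `w ≤ 1 / σ` on `Ω̄ × [0, T)`
    (∀ x ∈ closure Ω, ∀ t ∈ Ico 0 T,
      HypFlow.slopeW (gradientWithin (fun y => u y t) (closure Ω) x) ≤ 1 / σ) ∧
    -- the linearized operator satisfies the maximum principle
    HypFlow.LinearizedMaximumPrinciple f Ω T u := by
  have hO := hΩ.isOpen
  have hB := hΩ.isBounded
  have hgrad : ∀ x ∈ closure Ω, ∀ t ∈ Ico 0 T,
      HypFlow.slopeW (gradientWithin (fun y => u y t) (closure Ω) x) ≤ 1 / σ := fun x hx t ht =>
    (HypFlow.slopeW_le_iff hσ hσ').2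
      (hu.norm_gradient_le hn hf hΩ hH hσ hσ' hε hT hF₀ hw₀ hx ht)
  have hloc : ∀ z ∈ HypFlow.closedCylinderOffCorner Ω T,
      HypFlow.kappa Ω (fun y => u y z.2) z.1 ∈ K ∧
      (∃ Gu : ℝ, 0 ≤ Gu ∧
        HasDerivAt (fun ζ : ℝ => HypFlow.opG f
          (HypFlow.hessWithin (fun y => u y z.2) (closure Ω) z.1)
          (gradientWithin (fun y => u y z.2) (closure Ω) z.1) ζ
          (HypFlow.timeDeriv T u z.1 z.2)) Gu (u z.1 z.2)) ∧
      f (HypFlow.kappa Ω (fun y => u y z.2) z.1) ≤ σ := by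
    rintro ⟨x, t⟩ ⟨⟨hx, ht⟩, hcor⟩
    simp only at hx ht hcor ⊢
    have hKF : HypFlow.kappa Ω (fun y => u y t) x ∈ K ∧
        f (HypFlow.kappa Ω (fun y => u y t) x) ≤ σ := by
      by_cases hxΩ : x ∈ Ω
      · exact ⟨hu.admissible x hxΩ t ht, hu.curvature_le hf hO hB hσ hε hF₀ hxΩ ht⟩
      -- Off the corner a boundary point has `t > 0`, where the equation extends by continuity.
      · obtain ⟨h1, h2⟩ := hu.kappa_mem_of_mem_frontier hf hO hσ hε
          (HypFlow.mem_frontier_of_notMem hO hx hxΩ) ⟨hcor.resolve_left hxΩ, ht.2⟩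
        exact ⟨h1, h2.le⟩
    exact ⟨hKF.1, hf.exists_deriv_height_nonneg (hu.pos_of_mem_closure hO hε hx ht) hσ hKF.1
      (hu.timeDeriv_nonpos hf hO hB hσ hε hF₀ hx) hKF.2 (hgrad x hx t ht), hKF.2⟩
  exact ⟨hloc, hgrad, hu.linearizedMaximumPrinciple hf hO hB fun x hx t ht =>
    (hloc (x, t) ⟨⟨subset_closure hx, ht⟩, Or.inl hx⟩).2.1⟩
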